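/- **Setting.** Let $d,K\ge 1$, $T\ge 2$. There are $K$ arms. A problem instance consists of an unknown $\theta^*\in\mathbb R^d$, a fixed (obliviously chosen) sequence of true contexts $x^*_{t,i}\in\mathbb R^d$, $\|x^*_{t,i}\|_2\le 1$ ($t\in[T]$, $i\in[K]$), and noise. In round $t$ every arm $i$ observes $x^*_{t,i}$ and reports some $x_{t,i}$ with $\|x_{t,i}\|_2\le 1$; the learner sees only the reports, selects an arm $i_t$, and receives $r_t=\langle\theta^*,x^*_{t,i_t}\rangle+\eta_t$. Given the past and $i_t$, $\eta_t$ is zero-mean $1$-sub-Gaussian: $\mathbb E[e^{u\eta_t}\mid\cdot]\le e^{u^2/2}$ for all $u\in\mathbb R$. Assume $\|\theta^*\|_2\le S$ and $\langle\theta^*,x^*_{t,i}-x^*_{t,j}\rangle\le 1$ for all $t,i,j$. A strategy $\sigma_i$ of arm $i$ gives, in each round, a distribution of the report depending on the full history (reports, selections, rewards) and on the true context; given the history the arms randomise independently. The truthful strategy $\sigma_i^*$ reports $x_{t,i}=x^*_{t,i}$ always; $\boldsymbol\sigma^*=(\sigma^*_1,\dots,\sigma^*_K)$. **Mechanism OptGTM**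 (with $\lambda>0$, $S$, $T$ given). For each arm $i$ let $n$ be the number of its pulls before round $t$, and $$V_{t,i}=\lambda I+\sum_{\ell<t:\,i_\ell=i}x_{\ell,i}x_{\ell,i}^\top,\quad \hat\theta_{t,i}=V_{t,i}^{-1}\sum_{\ell<t:\,i_\ell=i}x_{\ell,i}r_\ell,\quad \sqrt{\beta_{t,i}}=\sqrt{d\log\Big(\frac{1+n/\lambda}{1/T^2}\Big)}+\sqrt\lambda\,S,$$ $C_{t,i}=\{\theta:\|\hat\theta_{t,i}-\theta\|^2_{V_{t,i}}\le\beta_{t,i}\}$, $\mathrm{UCB}_{t,i}(x)=\langle\hat\theta_{t,i},x\rangle+\sqrt{\beta_{t,i}}\|x\|_{V_{t,i}^{-1}}$ and $\mathrm{LCB}_{t,i}(x)=\langle\hat\theta_{t,i},x\rangle-\sqrt{\beta_{t,i}}\|x\|_{V_{t,i}^{-1}}$. All arms are active initially. In round $t$ an active arm $i_t$ maximising $\mathrm{UCB}_{t,i}(x_{t,i})$ over the active arms is played (ties are broken by an arbitrary, possibly randomised, fixed rule); afterwards $i=i_t$ is eliminated for all remaining rounds if $$\sum_{\ell\le t:\,i_\ell=i}\mathrm{LCB}_{\ell,i}(x_{\ell,i})>\sum_{\ell\le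 t:\,i_\ell=i}r_\ell+2\sqrt{n_t(i)\log T},\qquad n_t(i)=\#\{\ell\le t: i_\ell=i\}.$$ If no arm is active, no arm is played and the reward is zero in all remaining rounds. **Utility, equilibrium, regret.** The utility of arm $i$ under $\boldsymbol\sigma$ is $\mathbb E_{\boldsymbol\sigma}[n_T(i)]$. A strategy $\sigma_i'$ of arm $i$ is an admissible deviation from $\boldsymbol\sigma$ if under $(\sigma_i',\boldsymbol\sigma_{-i})$, with probability at least $1-1/T$, arm $i$ never under-reports: $\max_{\theta\in C_{t,i}}\langle\theta,x_{t,i}\rangle\ge\langle\theta^*,x^*_{t,i}\rangle$ for all $t\in[T]$. The profile $\boldsymbol\sigma$ is an $\varepsilon$-NE if $\mathbb E_{\boldsymbol\sigma}[n_T(i)]\ge\mathbb E_{\sigma_i',\boldsymbol\sigma_{-i}}[n_T(i)]-\varepsilon$ for every arm $i$ and every admissible deviation $\sigma'_i$. The strategic regret is $R_T(\boldsymbol\sigma)=\mathbb E_{\boldsymbol\sigma}\big[\sum_{t=1}^T\big(\max_i\langle\theta^*,x^*_{t,i}\rangle-\langle\theta^*,x^*_{t,i_t}\rangle\big)\big]$,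 where the second term is $0$ in a round in which no arm is played. **Theorem.** For all $\lambda>0$, $S$ and $\Delta>0$ there is a constant $C$, depending only on $\lambda,S,\Delta$, such that for all $d,K\ge1$, $T\ge2$, every tie-breaking rule and every instance as above: 1. if in each round $t\in[T]$ there is an arm $i_t^*$ with $\langle\theta^*,x^*_{t,i^*_t}-x^*_{t,j}\rangle\ge\Delta$ for all $j\ne i_t^*$, then $\boldsymbol\sigma^*$ is a $C\,d\log(T)\sqrt{KT}$-NE under OptGTM, i.e. an $\tilde{\mathcal O}(d\sqrt{KT})$-NE; 2. under the truthful profile, $R_T(\boldsymbol\sigma^*)\le C\,d\log(T)\sqrt{KT}=\tilde{\mathcal O}(d\sqrt{KT})$. -/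

import Mathlib

open MeasureTheory ProbabilityTheory

namespace StrategicBandit

/-! ### The interaction: contexts, rounds, histories -/

/-- A (true or reported) context: a vector of Euclidean norm at most one in `ℝ^d`. -/
abbrev Ctx (d : ℕ) : Type := Metric.closedBall (0 : EuclideanSpace ℝ (Fin d)) 1

/-- The outcome of one round: the reported contexts `(x_{t,1}, …, x_{t,K})`, the selected arm
(`none` when the learner no longer plays any arm), and the reward. -/
abbrev Round (d K : ℕ) : Type := (Fin K → Ctx d) × Option (Fin K) × ℝ

/-- What happened in the first `t` rounds. Rounds are numbered from `0`, so this is everything that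
precedes round `t`. -/
abbrev History (d K t : ℕ) : Type := Fin t → Round d K

instance instMeasurableSpaceOptionFin (K : ℕ) : MeasurableSpace (Option (Fin K)) := ⊤

instance instDiscreteOptionFin (K : ℕ) : DiscreteMeasurableSpace (Option (Fin K)) :=
  ⟨fun _ => trivial⟩

variable {d K t T : ℕ}

/-- The reported context of arm `i` in round `ℓ`. -/
def History.report (h : History d K t) (ℓ : Fin t) (i : Fin K) : EuclideanSpace ℝ (Fin d) :=
  ((h ℓ).1 i : EuclideanSpace ℝ (Fin d))

/-- The arm `i_ℓ` selected in round `ℓ`. -/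
def History.arm (h : History d K t) (ℓ : Fin t) : Option (Fin K) := (h ℓ).2.1

/-- The reward received in round `ℓ`. -/
def History.reward (h : History d K t) (ℓ : Fin t) : ℝ := (h ℓ).2.2

/-- The part of the history that precedes round `s`. -/
def History.before (h : History d K t) (s : ℕ) (hs : s ≤ t) : History d K s :=
  fun ℓ => h (Fin.castLE hs ℓ)

/-- The number of pulls of arm `i` in the history. -/
def History.numPulls (h : History d K t) (i : Fin K) : ℕ :=
  (Finset.univ.filter fun ℓ : Fin t => h.arm ℓ = some i).card

/-! ### The Optimistic Grim Trigger Mechanism -/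

/-- What the mechanism is run with: the horizon `T`, the ridge penalty `lam`, and an upper bound `S`
on the norm of the unknown parameter. -/
structure Params where
  T : ℕ
  lam : ℝ
  S : ℝ

/-- The norm `‖x‖_M = √(xᵀ M x)`. -/
noncomputable def matNorm (M : Matrix (Fin d) (Fin d) ℝ) (x : EuclideanSpace ℝ (Fin d)) : ℝ :=
  √(x.ofLp ⬝ᵥ Matrix.mulVec M x.ofLp)

/-- `V_{t,i} = λ I + ∑_{ℓ < t, i_ℓ = i} x_{ℓ,i} x_{ℓ,i}ᵀ`. -/
noncomputable def gram (P : Params) (h : History d K t) (i : Fin K) : Matrix (Fin d) (Fin d) ℝ :=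
  P.lam • (1 : Matrix (Fin d) (Fin d) ℝ) +
    ∑ ℓ : Fin t, if h.arm ℓ = some i then
      Matrix.vecMulVec (h.report ℓ i).ofLp (h.report ℓ i).ofLp else 0

/-- The ridge-regression estimator of arm `i` from its own reported contexts and rewards,
`V_{t,i}⁻¹ ∑_{ℓ < t, i_ℓ = i} r_ℓ x_{ℓ,i}`: the minimiser of
`∑_{ℓ < t, i_ℓ = i} (⟪θ, x_{ℓ,i}⟫ - r_ℓ)² + λ ‖θ‖²`. -/
noncomputable def thetaHat (P : Params) (h : History d K t) (i : Fin K) :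
    EuclideanSpace ℝ (Fin d) :=
  WithLp.toLp 2 (Matrix.mulVec (gram P h i)⁻¹
    (∑ ℓ : Fin t, if h.arm ℓ = some i then h.reward ℓ • (h.report ℓ i).ofLp else 0))

/-- The confidence size `β_{t,i} = (√(d log((1 + n/λ)/δ)) + √λ S)²` with `δ = 1/T²`, where `n` is
the number of pulls of arm `i` before round `t`. -/
noncomputable def beta (P : Params) (h : History d K t) (i : Fin K) : ℝ :=
  (√(d * Real.log ((1 + h.numPulls i / P.lam) / (1 / (P.T : ℝ) ^ 2))) + √P.lam * P.S) ^ 2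

/-- The confidence set `C_{t,i} = {θ : ‖θ̂_{t,i} - θ‖²_{V_{t,i}} ≤ β_{t,i}}`. -/
def confSet (P : Params) (h : History d K t) (i : Fin K) : Set (EuclideanSpace ℝ (Fin d)) :=
  {θ | matNorm (gram P h i) (thetaHat P h i - θ) ^ 2 ≤ beta P h i}

/-- `UCB_{t,i}(x) = ⟪θ̂_{t,i}, x⟫ + √β_{t,i} ‖x‖_{V_{t,i}⁻¹}`. -/
noncomputable def ucb (P : Params) (h : History d K t) (i : Fin K)
    (x : EuclideanSpace ℝ (Fin d)) : ℝ :=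
  inner ℝ (thetaHat P h i) x + √(beta P h i) * matNorm (gram P h i)⁻¹ x

/-- `LCB_{t,i}(x) = ⟪θ̂_{t,i}, x⟫ - √β_{t,i} ‖x‖_{V_{t,i}⁻¹}`. -/
noncomputable def lcb (P : Params) (h : History d K t) (i : Fin K)
    (x : EuclideanSpace ℝ (Fin d)) : ℝ :=
  inner ℝ (thetaHat P h i) x - √(beta P h i) * matNorm (gram P h i)⁻¹ x

/-- The grim trigger condition for arm `i`, evaluated at the end of the last round of `h`:
`∑_ℓ LCB_{ℓ,i}(x_{ℓ,i}) > ∑_ℓ r_ℓ + 2 √(n(i) log T)`, both sums over the rounds `ℓ` of `h` in which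
arm `i` was pulled, and each `LCB_{ℓ,i}` computed from what preceded round `ℓ`. -/
def triggered (P : Params) (h : History d K t) (i : Fin K) : Prop :=
  (∑ ℓ : Fin t, if h.arm ℓ = some i then h.reward ℓ else 0)
      + 2 * √(h.numPulls i * Real.log P.T)
    < ∑ ℓ : Fin t, if h.arm ℓ = some i then
        lcb P (h.before ℓ ℓ.2.le) i (h.report ℓ i) else 0

open Classical in
/-- The active set `A_t`: the arms for which the grim trigger was never satisfied at the end of a
round in which they were pulled. -/
noncomputable def active (P : Params) (h : History d K t) : Finset (Fin K) :=
  Finset.univ.filter fun i =>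
    ∀ s : Fin t, h.arm s = some i → ¬ triggered P (h.before (s + 1) s.2) i

open Classical in
/-- The active arms whose reported optimistic reward `UCB_{t,i}(x_{t,i})` is maximal among the
active arms. -/
noncomputable def argmaxSet (P : Params) (h : History d K t) (x : Fin K → Ctx d) :
    Finset (Fin K) :=
  (active P h).filter fun i => ∀ j ∈ active P h, ucb P h j (x j) ≤ ucb P h i (x i)

/-- How ties in the `argmax` are broken: in each round, a distribution on the set of maximisers. -/
structure TieBreak (K : ℕ) where
  law : ℕ → Finset (Fin K) → PMF (Fin K)
  mem : ∀ t s, s.Nonempty → ∀ i ∈ (law t s).support, i ∈ s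

open Classical in
/-- The law of the selected arm, given the set of maximisers; no arm is played if there is none,
that is, if no arm is active. -/
noncomputable def selectMeasure (tie : TieBreak K) (t : ℕ) (s : Finset (Fin K)) :
    Measure (Option (Fin K)) :=
  if s.Nonempty then ((tie.law t s).map some).toMeasure else Measure.dirac none

/-! ### Measurability of the mechanism -/

section Measurability

lemma measurable_report (ℓ : Fin t) (i : Fin K) :
    Measurable fun h : History d K t => h.report ℓ i := by
  unfold History.report; fun_prop

lemma measurable_reward (ℓ : Fin t) :
    Measurable fun h : History d K t => h.reward ℓ := by
  unfold History.reward; fun_prop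

lemma measurable_arm (ℓ : Fin t) : Measurable fun h : History d K t => h.arm ℓ := by
  unfold History.arm; fun_prop

lemma measurableSet_arm (ℓ : Fin t) (a : Option (Fin K)) :
    MeasurableSet {h : History d K t | h.arm ℓ = a} :=
  measurable_arm ℓ (measurableSet_singleton a)

lemma measurable_before (s : ℕ) (hs : s ≤ t) :
    Measurable fun h : History d K t => h.before s hs := by
  unfold History.before; fun_prop

lemma measurable_numPulls (i : Fin K) :
    Measurable fun h : History d K t => (h.numPulls i : ℝ) := by
  simp only [History.numPulls, Finset.card_filter, Nat.cast_sum]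
  refine Finset.measurable_sum _ fun ℓ _ => ?_
  simp only [Nat.cast_ite]
  exact Measurable.ite (measurableSet_arm ℓ _) measurable_const measurable_const

lemma measurable_det {α : Type*} [MeasurableSpace α] {n : ℕ} {M : α → Matrix (Fin n) (Fin n) ℝ}
    (hM : ∀ a b, Measurable fun z => M z a b) : Measurable fun z => (M z).det := by
  simp only [Matrix.det_apply]
  refine Finset.measurable_sum _ fun σ _ => ?_
  exact (Finset.measurable_prod _ fun i _ => hM _ _).const_smul _

lemma measurable_inv {α : Type*} [MeasurableSpace α] {n : ℕ} {M : α → Matrix (Fin n) (Fin n) ℝ}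
    (hM : ∀ a b, Measurable fun z => M z a b) (a b : Fin n) :
    Measurable fun z => (M z)⁻¹ a b := by
  simp only [Matrix.inv_def, Matrix.smul_apply, smul_eq_mul, Matrix.adjugate_apply,
    Ring.inverse_eq_inv']
  refine (measurable_det hM).inv.mul (measurable_det fun c e => ?_)
  by_cases hc : c = b
  · subst hc; simp
  · simpa [Matrix.updateRow_apply, hc] using hM c e

lemma measurable_gram (P : Params) (i : Fin K) (a b : Fin d) :
    Measurable fun h : History d K t => gram P h i a b := by
  simp only [gram, Matrix.add_apply, Matrix.sum_apply]
  refine measurable_const.add (Finset.measurable_sum _ fun ℓ _ => ?_)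
  have : (fun h : History d K t => (if h.arm ℓ = some i then
      Matrix.vecMulVec (h.report ℓ i).ofLp (h.report ℓ i).ofLp else 0) a b) =
      fun h => if h.arm ℓ = some i then (h.report ℓ i) a * (h.report ℓ i) b else 0 := by
    funext h; split_ifs <;> simp [Matrix.vecMulVec_apply]
  rw [this]
  have hr := measurable_report (d := d) ℓ i
  exact Measurable.ite (measurableSet_arm ℓ _) (by fun_prop) measurable_const

lemma measurable_thetaHat (P : Params) (i : Fin K) (a : Fin d) :
    Measurable fun h : History d K t => thetaHat P h i a := by
  simp only [thetaHat, Matrix.mulVec, dotProduct, Finset.sum_apply]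
  refine Finset.measurable_sum _ fun b _ => (measurable_inv (measurable_gram P i) a b).mul ?_
  refine Finset.measurable_sum _ fun ℓ _ => ?_
  have : (fun h : History d K t => (if h.arm ℓ = some i then
      h.reward ℓ • (h.report ℓ i).ofLp else 0) b) =
      fun h => if h.arm ℓ = some i then h.reward ℓ * (h.report ℓ i) b else 0 := by
    funext h; split_ifs <;> simp
  rw [this]
  have hr := measurable_report (d := d) ℓ i
  have hw := measurable_reward (d := d) (K := K) ℓ
  exact Measurable.ite (measurableSet_arm ℓ _) (by fun_prop) measurable_const

lemma measurable_bonus (P : Params) (i : Fin K) :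
    Measurable fun p : History d K t × EuclideanSpace ℝ (Fin d) =>
      √(beta P p.1 i) * matNorm (gram P p.1 i)⁻¹ p.2 := by
  have hn : Measurable fun p : History d K t × EuclideanSpace ℝ (Fin d) =>
      (p.1.numPulls i : ℝ) := (measurable_numPulls i).comp measurable_fst
  have hb : Measurable fun p : History d K t × EuclideanSpace ℝ (Fin d) => beta P p.1 i := by
    unfold beta; fun_prop
  refine hb.sqrt.mul ?_
  simp only [matNorm, dotProduct, Matrix.mulVec]
  refine Measurable.sqrt (Finset.measurable_sum _ fun a _ => Measurable.mul (by fun_prop)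
    (Finset.measurable_sum _ fun b _ => Measurable.mul ?_ (by fun_prop)))
  exact (measurable_inv (measurable_gram P i) a b).comp measurable_fst

lemma measurable_pred (P : Params) (i : Fin K) :
    Measurable fun p : History d K t × EuclideanSpace ℝ (Fin d) =>
      (inner ℝ (thetaHat P p.1 i) p.2 : ℝ) := by
  simp only [PiLp.inner_apply, RCLike.inner_apply, conj_trivial]
  refine Finset.measurable_sum _ fun a _ => Measurable.mul (by fun_prop) ?_
  exact (measurable_thetaHat P i a).comp measurable_fst

lemma measurable_ucb {α : Type*} [MeasurableSpace α] (P : Params) (i : Fin K)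
    {H : α → History d K t} (hH : Measurable H) {X : α → EuclideanSpace ℝ (Fin d)}
    (hX : Measurable X) : Measurable fun z => ucb P (H z) i (X z) := by
  have h1 := (measurable_pred (t := t) P i).comp (hH.prodMk hX)
  have h2 := (measurable_bonus (t := t) P i).comp (hH.prodMk hX)
  exact h1.add h2

lemma measurable_lcb {α : Type*} [MeasurableSpace α] (P : Params) (i : Fin K)
    {H : α → History d K t} (hH : Measurable H) {X : α → EuclideanSpace ℝ (Fin d)}
    (hX : Measurable X) : Measurable fun z => lcb P (H z) i (X z) := by
  have h1 := (measurable_pred (t := t) P i).comp (hH.prodMk hX)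
  have h2 := (measurable_bonus (t := t) P i).comp (hH.prodMk hX)
  exact h1.sub h2

lemma measurable_triggered (P : Params) (i : Fin K) :
    Measurable fun h : History d K t => triggered P h i := by
  have h1 : Measurable fun h : History d K t =>
      (∑ ℓ : Fin t, if h.arm ℓ = some i then h.reward ℓ else 0)
        + 2 * √(h.numPulls i * Real.log P.T) := by
    refine Measurable.add (Finset.measurable_sum _ fun ℓ _ => ?_) ?_
    · exact Measurable.ite (measurableSet_arm ℓ _) (measurable_reward ℓ) measurable_const
    · have hn := measurable_numPulls (d := d) (t := t) i
      fun_prop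
  have h2 : Measurable fun h : History d K t => ∑ ℓ : Fin t, if h.arm ℓ = some i then
        lcb P (h.before ℓ ℓ.2.le) i (h.report ℓ i) else 0 := by
    refine Finset.measurable_sum _ fun ℓ _ => ?_
    have h3 : Measurable fun h : History d K t =>
        lcb P (h.before ℓ ℓ.2.le) i (h.report ℓ i) :=
      measurable_lcb P i (measurable_before _ _) (measurable_report ℓ i)
    exact Measurable.ite (measurableSet_arm ℓ _) h3 measurable_const
  exact measurableSet_setOfPred.1 (measurableSet_lt h1 h2)

lemma measurable_mem_active (P : Params) (i : Fin K) :
    Measurable fun h : History d K t => i ∈ active P h := by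
  simp only [active, Finset.mem_filter, Finset.mem_univ, true_and]
  refine Measurable.forall fun s => Measurable.imp ?_ (Measurable.not ?_)
  · exact measurableSet_setOfPred.1 (measurableSet_arm s _)
  · exact (measurable_triggered P i).comp (measurable_before _ _)

lemma measurable_mem_argmaxSet (P : Params) (i : Fin K) :
    Measurable fun p : History d K t × (Fin K → Ctx d) => i ∈ argmaxSet P p.1 p.2 := by
  have hu : ∀ j : Fin K, Measurable fun p : History d K t × (Fin K → Ctx d) =>
      ucb P p.1 j (p.2 j) := fun j =>
    measurable_ucb P j measurable_fst (by fun_prop)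
  have ha : ∀ j : Fin K, Measurable fun p : History d K t × (Fin K → Ctx d) =>
      j ∈ active P p.1 := fun j => (measurable_mem_active P j).comp measurable_fst
  simp only [argmaxSet, Finset.mem_filter]
  refine (ha i).and (Measurable.forall fun j => (ha j).imp ?_)
  exact measurableSet_setOfPred.1 (measurableSet_le (hu j) (hu i))

lemma measurableSet_argmaxSet_eq (P : Params) (s : Finset (Fin K)) :
    MeasurableSet {p : History d K t × (Fin K → Ctx d) | argmaxSet P p.1 p.2 = s} := by
  refine measurableSet_setOfPred.2 ?_
  simp only [Finset.ext_iff]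
  exact Measurable.forall fun i => (measurable_mem_argmaxSet P i).iff measurable_const

lemma measurable_selectMeasure (P : Params) (tie : TieBreak K) :
    Measurable fun p : History d K t × (Fin K → Ctx d) =>
      selectMeasure tie t (argmaxSet P p.1 p.2) := by
  intro B _
  have : (fun p : History d K t × (Fin K → Ctx d) =>
      selectMeasure tie t (argmaxSet P p.1 p.2)) ⁻¹' B =
      ⋃ s ∈ {s | selectMeasure tie t s ∈ B}, {p | argmaxSet P p.1 p.2 = s} := by
    ext p; simp
  rw [this]
  exact MeasurableSet.biUnion (Set.to_countable _) fun s _ => measurableSet_argmaxSet_eq P s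

end Measurability

/-- The arm selected by the mechanism in round `t`, given the history and the reported contexts. -/
noncomputable def selectKernel (P : Params) (tie : TieBreak K) (t : ℕ) :
    Kernel (History d K t × (Fin K → Ctx d)) (Option (Fin K)) where
  toFun p := selectMeasure tie t (argmaxSet P p.1 p.2)
  measurable' := measurable_selectMeasure P tie

/-! ### Environment and strategies -/

/-- A problem instance: the unknown parameter `θ*`, the true contexts `x*_{t,i}`, and the law of the
noise `η_t` given what precedes round `t` and the arm that is pulled in round `t`. -/
structure Env (d K : ℕ) where
  θ : EuclideanSpace ℝ (Fin d)
  ctx : ℕ → Fin K → Ctx d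
  noise : (t : ℕ) → Fin K → Kernel (History d K t) ℝ
  noise_markov : ∀ t i, IsMarkovKernel (noise t i)

/-- The mean reward `⟪θ*, x*_{t,i}⟫`. -/
noncomputable def Env.mean (E : Env d K) (t : ℕ) (i : Fin K) : ℝ :=
  inner ℝ E.θ (E.ctx t i : EuclideanSpace ℝ (Fin d))

/-- The standing assumptions over the first `T` rounds: `‖θ*‖ ≤ S`, the mean rewards of two arms in
the same round differ by at most one, and the noise is conditionally `1`-sub-Gaussian,
`𝔼[exp(u η_t) | past] ≤ exp(u²/2)` for all real `u` (which entails conditional mean zero). -/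
structure Env.Regular (E : Env d K) (S : ℝ) (T : ℕ) : Prop where
  norm_le : ‖E.θ‖ ≤ S
  spread : ∀ t < T, ∀ i j, E.mean t i - E.mean t j ≤ 1
  subgaussian : ∀ t < T, ∀ (i : Fin K) (h : History d K t),
    HasSubgaussianMGF (fun η : ℝ => η) 1 (E.noise t i h)

/-- In each of the first `T` rounds there is one optimal arm `i*_t`, and every other arm is
suboptimal by at least `Δ`. -/
def Env.HasGap (E : Env d K) (Δ : ℝ) (T : ℕ) : Prop :=
  ∀ t < T, ∃ i, ∀ j, j ≠ i → E.mean t j + Δ ≤ E.mean t i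

/-- A mixed, history-dependent reporting strategy of an arm: for every round, the distribution of
the reported context given the history and the arm's true context in that round. -/
structure Strategy (d K : ℕ) where
  law : (t : ℕ) → Kernel (History d K t × Ctx d) (Ctx d)
  markov : ∀ t, IsMarkovKernel (law t)

/-- The truthful strategy `σ*_i`. -/
noncomputable def truthful : Strategy d K where
  law _ := Kernel.deterministic (fun p => p.2) measurable_snd
  markov _ := inferInstance

/-- The joint law of the reports in round `t` given the history: the arms randomise independently. -/
noncomputable def reportKernel (E : Env d K) (σ : Fin K → Strategy d K) (t : ℕ) :
    Kernel (History d K t) (Fin K → Ctx d) where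
  toFun h := Measure.pi fun i => (σ i).law t (h, E.ctx t i)
  measurable' := by
    have hm : ∀ i, IsMarkovKernel ((σ i).law t) := fun i => (σ i).markov t
    refine Measurable.measure_of_isPiSystem_of_isProbabilityMeasure generateFrom_pi.symm
      isPiSystem_pi ?_
    rintro _ ⟨s, hs, rfl⟩
    simp only [Measure.pi_pi]
    refine Finset.measurable_prod _ fun i _ => ?_
    have hsi : MeasurableSet (s i) := hs i (Set.mem_univ i)
    exact (Kernel.measurable_coe _ hsi).comp (measurable_id.prodMk measurable_const)

/-- The law of the reward in round `t` given the history and the selected arm `i`, namely that of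
`⟪θ*, x*_{t,i}⟫ + η_t`; the reward is zero if no arm is played. -/
noncomputable def rewardMeasure (E : Env d K) (t : ℕ) (h : History d K t) :
    Option (Fin K) → Measure ℝ
  | none => Measure.dirac 0
  | some i => (E.noise t i h).map fun η => E.mean t i + η

/-- `rewardMeasure` as a kernel. -/
noncomputable def rewardKernel (E : Env d K) (t : ℕ) :
    Kernel (History d K t × Option (Fin K)) ℝ where
  toFun p := rewardMeasure E t p.1 p.2
  measurable' := by
    refine measurable_from_prod_countable_left fun a => ?_
    cases a with
    | none => exact measurable_const
    | some i =>
      exact (Measure.measurable_map _ (measurable_const_add _)).comp (E.noise t i).measurable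

/-- One round: the arms report, the mechanism selects an arm, the reward is drawn. -/
noncomputable def stepKernel (P : Params) (tie : TieBreak K) (E : Env d K)
    (σ : Fin K → Strategy d K) (t : ℕ) : Kernel (History d K t) (Round d K) :=
  (reportKernel E σ t) ⊗ₖ ((selectKernel P tie t) ⊗ₖ
    ((rewardKernel E t).comap (fun p => (p.1.1, p.2))
      ((measurable_fst.comp measurable_fst).prodMk measurable_snd)))

/-- The law of the first `t` rounds when the mechanism interacts with arms that play `σ`. -/
noncomputable def law (P : Params) (tie : TieBreak K) (E : Env d K)
    (σ : Fin K → Strategy d K) : (t : ℕ) → Measure (History d K t)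
  | 0 => Measure.dirac Fin.elim0
  | t + 1 => ((law P tie E σ t) ⊗ₘ (stepKernel P tie E σ t)).map
      fun p => Fin.snoc (α := fun _ => Round d K) p.1 p.2

instance instMarkovReport (E : Env d K) (σ : Fin K → Strategy d K) (t : ℕ) :
    IsMarkovKernel (reportKernel E σ t) := by
  have hm : ∀ i, IsMarkovKernel ((σ i).law t) := fun i => (σ i).markov t
  refine ⟨fun h => ?_⟩
  change IsProbabilityMeasure (Measure.pi fun i => (σ i).law t (h, E.ctx t i))
  infer_instance

instance instMarkovSelect (P : Params) (tie : TieBreak K) (t : ℕ) :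
    IsMarkovKernel (selectKernel (d := d) P tie t) := by
  refine ⟨fun p => ?_⟩
  change IsProbabilityMeasure (selectMeasure tie t (argmaxSet P p.1 p.2))
  unfold selectMeasure
  split_ifs <;> infer_instance

instance instMarkovReward (E : Env d K) (t : ℕ) : IsMarkovKernel (rewardKernel E t) := by
  have hn : ∀ i, IsMarkovKernel (E.noise t i) := fun i => E.noise_markov t i
  refine ⟨fun p => ?_⟩
  obtain ⟨h, _ | i⟩ := p
  · change IsProbabilityMeasure (Measure.dirac (0 : ℝ))
    infer_instance
  · change IsProbabilityMeasure ((E.noise t i h).map fun η => E.mean t i + η)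
    exact Measure.isProbabilityMeasure_map (measurable_const_add _).aemeasurable

instance instMarkovStep (P : Params) (tie : TieBreak K) (E : Env d K)
    (σ : Fin K → Strategy d K) (t : ℕ) : IsMarkovKernel (stepKernel P tie E σ t) := by
  unfold stepKernel; infer_instance

lemma measurable_snoc : Measurable fun p : History d K t × Round d K =>
    (Fin.snoc (α := fun _ => Round d K) p.1 p.2 : History d K (t + 1)) := by
  refine measurable_pi_iff.2 fun ℓ => ?_
  induction ℓ using Fin.lastCases with
  | last => simpa using measurable_snd
  | cast j =>
    simp only [Fin.snoc_castSucc]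
    exact (measurable_pi_apply j).comp measurable_fst

instance instProbabilityLaw (P : Params) (tie : TieBreak K) (E : Env d K)
    (σ : Fin K → Strategy d K) (t : ℕ) : IsProbabilityMeasure (law P tie E σ t) := by
  induction t with
  | zero => unfold law; infer_instance
  | succ t ih =>
    unfold law
    exact Measure.isProbabilityMeasure_map measurable_snoc.aemeasurable

/-! ### Utilities, approximate equilibria, strategic regret -/

/-- The utility of arm `i`: the expected number `𝔼[n_T(i)]` of its pulls in `T` rounds. -/
noncomputable def utility (P : Params) (tie : TieBreak K) (E : Env d K)
    (σ : Fin K → Strategy d K) (i : Fin K) : ℝ :=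
  ∫ h, (h.numPulls i : ℝ) ∂(law P tie E σ P.T)

/-- In every round `t`, the optimistic value of arm `i`'s report is at least its true value:
`max_{θ ∈ C_{t,i}} ⟪θ, x_{t,i}⟫ ≥ ⟪θ*, x*_{t,i}⟫`. -/
def NoUnderReport (P : Params) (E : Env d K) (h : History d K T) (i : Fin K) : Prop :=
  ∀ t : Fin T, ∃ θ ∈ confSet P (h.before t t.2.le) i, E.mean t i ≤ inner ℝ θ (h.report t i)

/-- Under the profile `σ`, arm `i` does not under-report, except with probability at most `1/T`. -/
def Admissible (P : Params) (tie : TieBreak K) (E : Env d K)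
    (σ : Fin K → Strategy d K) (i : Fin K) : Prop :=
  law P tie E σ P.T {h | ¬ NoUnderReport P E h i} ≤ (P.T : ENNReal)⁻¹

/-- `σ` is an `ε`-Nash equilibrium of the arms: no arm gains more than `ε` in utility by switching to
another strategy with which it does not under-report. -/
def IsApproxNE (P : Params) (tie : TieBreak K) (E : Env d K) (ε : ℝ)
    (σ : Fin K → Strategy d K) : Prop :=
  ∀ (i : Fin K) (σ' : Strategy d K), Admissible P tie E (Function.update σ i σ') i →
    utility P tie E (Function.update σ i σ') i - ε ≤ utility P tie E σ i

/-- The strategic regret `𝔼[∑_t (max_i ⟪θ*, x*_{t,i}⟫ - ⟪θ*, x*_{t,i_t}⟫)]`; a round in which no arm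
is played contributes zero reward. -/
noncomputable def regret (P : Params) (tie : TieBreak K) (E : Env d K)
    (σ : Fin K → Strategy d K) : ℝ :=
  ∫ h, (∑ t : Fin P.T, ((⨆ i, E.mean t i) - (h.arm t).elim 0 (E.mean t)))
    ∂(law P tie E σ P.T)

end StrategicBandit

/-! The rewards of an arm are its true means plus sub-Gaussian noise, whatever the arms report and
however ties are broken, so the concentration bounds hold under every profile. The rest is a
deterministic argument along histories in a good event.

A truthful arm is `Reliable` outside an event of probability `2/T`: a self-normalised bound
(`law_not_covered_le`) puts `θ*` into its confidence sets, and its total noise never falls below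
`-2√(n log T)` (`law_not_concentrated_le`). Then LCB ≤ true mean ≤ UCB in every round, so the arm is
never eliminated. If all arms are reliable, a round's regret is at most twice the confidence width
of the arm played. The widths over `n` pulls of one arm sum to `O(d log T √n)` by the elliptical
potential argument, for arbitrary reports (`sum_width_le`), and Cauchy–Schwarz over the arms gives
`√(KT)` (`pathRegret_le`).

For the equilibrium, both utilities are compared with the number of rounds in which arm `i` is
optimal. Under truthful play each such round without a pull of `i` costs regret `Δ`
(`numOptimal_sub_numPulls_le`). Under a deviation, a pull of `i` in any other round means that its
UCB beat that of a truthful optimal arm, hence exceeds the mean of `i` by `Δ`; in its remaining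
pulls the UCB is at least the mean, since `i` does not under-report. As long as `i` is active, the
trigger keeps the sum of its LCBs within `2√(n log T)` of its rewards, so this excess is paid for by
the widths and the noise alone (`Deviating.numWrong_mul_le`).

A failure event of probability `cK/T` with `c ≥ 1` costs at most a multiple of `min(T, cK) ≤ c√(KT)`
in expectation (`integral_le_of_le_off`). -/

namespace StrategicBandit

/-! ### Rank-one updates, weighted norms and determinants. -/

section LinearAlgebra

open Matrix

variable {d : ℕ} {V : Matrix (Fin d) (Fin d) ℝ}

lemma inv_mulVec_dotProduct_comm (hV : V.PosDef) (x y : Fin d → ℝ) :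
    x ⬝ᵥ V⁻¹ *ᵥ y = y ⬝ᵥ V⁻¹ *ᵥ x := by
  have hs : (V⁻¹)ᵀ = V⁻¹ := by
    simpa using hV.inv.isHermitian.eq
  rw [dotProduct_mulVec, ← mulVec_transpose, hs, dotProduct_comm]

lemma inv_quadForm_nonneg (hV : V.PosDef) (x : Fin d → ℝ) : 0 ≤ x ⬝ᵥ V⁻¹ *ᵥ x := by
  simpa using hV.inv.posSemidef.dotProduct_mulVec_nonneg x

lemma mulVec_inv_mulVec (hV : V.PosDef) (x : Fin d → ℝ) : V *ᵥ (V⁻¹ *ᵥ x) = x := by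
  rw [mulVec_mulVec, mul_nonsing_inv _ ((isUnit_iff_isUnit_det _).1 hV.isUnit), one_mulVec]

lemma inv_mulVec_mulVec (hV : V.PosDef) (x : Fin d → ℝ) : V⁻¹ *ᵥ (V *ᵥ x) = x := by
  rw [mulVec_mulVec, nonsing_inv_mul _ ((isUnit_iff_isUnit_det _).1 hV.isUnit), one_mulVec]

lemma posDef_add_vecMulVec (hV : V.PosDef) (x : Fin d → ℝ) : (V + vecMulVec x x).PosDef := by
  have := posSemidef_vecMulVec_self_star x
  simp only [star_trivial] at this
  exact hV.add_posSemidef this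

/-- The matrix determinant lemma. It makes `log det V` telescope over pulls, both in the
self-normalised supermartingale and in the elliptical potential. -/
lemma det_add_vecMulVec_self (hV : V.PosDef) (x : Fin d → ℝ) :
    (V + vecMulVec x x).det = V.det * (1 + x ⬝ᵥ V⁻¹ *ᵥ x) := by
  have h := det_add_replicateCol_mul_replicateRow (ι := Unit)
    ((isUnit_iff_isUnit_det _).1 hV.isUnit) x x
  rw [vecMulVec_eq Unit, h, det_unique (n := Unit), Matrix.mul_assoc, ← replicateCol_mulVec]
  simp [replicateRow_mul_replicateCol_apply]

lemma quadForm_update (hV : V.PosDef) (s x : Fin d → ℝ) (η : ℝ) :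
    (s + η • x) ⬝ᵥ (V + vecMulVec x x)⁻¹ *ᵥ (s + η • x) =
      s ⬝ᵥ V⁻¹ *ᵥ s + (2 * η * (x ⬝ᵥ V⁻¹ *ᵥ s) + η ^ 2 * (x ⬝ᵥ V⁻¹ *ᵥ x)
        - (x ⬝ᵥ V⁻¹ *ᵥ s) ^ 2) / (1 + x ⬝ᵥ V⁻¹ *ᵥ x) := by
  have ha := inv_quadForm_nonneg hV x
  have hsym := inv_mulVec_dotProduct_comm hV s x
  set a := x ⬝ᵥ V⁻¹ *ᵥ x with ha'
  set b := x ⬝ᵥ V⁻¹ *ᵥ s with hb'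
  have h1 : (1 + a) ≠ 0 := by positivity
  -- Sherman–Morrison in disguise: the updated linear system has a solution of the form `V⁻¹s + κ
  -- V⁻¹x`, and matching the coefficient of `x` gives `κ = (η - b)/(1 + a)`.
  have key : (V + vecMulVec x x) *ᵥ (V⁻¹ *ᵥ s + ((η - b) / (1 + a)) • V⁻¹ *ᵥ x) = s + η • x := by
    have hx : ∀ y, vecMulVec x x *ᵥ y = (x ⬝ᵥ y) • x := fun y => by
      simp [vecMulVec_mulVec]
    rw [add_mulVec, hx, mulVec_add, mulVec_smul, mulVec_inv_mulVec hV, mulVec_inv_mulVec hV,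
      dotProduct_add, dotProduct_smul, ← ha', ← hb', smul_eq_mul]
    ext k
    simp only [Pi.add_apply, Pi.smul_apply, smul_eq_mul]
    field_simp
    ring
  have hz : (V + vecMulVec x x)⁻¹ *ᵥ (s + η • x) =
      V⁻¹ *ᵥ s + ((η - b) / (1 + a)) • V⁻¹ *ᵥ x := by
    rw [← key, inv_mulVec_mulVec (posDef_add_vecMulVec hV x)]
  rw [hz]
  simp only [add_dotProduct, dotProduct_add, dotProduct_smul, smul_dotProduct, smul_eq_mul,
    ← ha', ← hb', hsym]
  field_simp
  ring

/-- A square root `B` of `V` turns the weighted norm into the Euclidean norm of `B x`, from which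
the triangle inequality, homogeneity and Cauchy–Schwarz are inherited. -/
lemma exists_matNorm_eq (hV : V.PosSemidef) :
    ∃ B : Matrix (Fin d) (Fin d) ℝ, V = Bᵀ * B ∧
      ∀ x : EuclideanSpace ℝ (Fin d), matNorm V x = ‖WithLp.toLp 2 (B *ᵥ x.ofLp)‖ := by
  obtain ⟨B, hB⟩ : ∃ B : Matrix (Fin d) (Fin d) ℝ, V = Bᵀ * B := by
    open scoped MatrixOrder in
    obtain ⟨B, hB⟩ := CStarAlgebra.nonneg_iff_eq_star_mul_self.1 hV.nonneg
    exact ⟨B, by simpa [star_eq_conjTranspose] using hB⟩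
  refine ⟨B, hB, fun x => ?_⟩
  rw [EuclideanSpace.norm_eq, matNorm, hB, ← mulVec_mulVec, dotProduct_mulVec, vecMul_transpose]
  congr 1
  simp [dotProduct, sq]

lemma matNorm_nonneg (M : Matrix (Fin d) (Fin d) ℝ) (x : EuclideanSpace ℝ (Fin d)) :
    0 ≤ matNorm M x := Real.sqrt_nonneg _

lemma matNorm_add_le (hV : V.PosSemidef) (x y : EuclideanSpace ℝ (Fin d)) :
    matNorm V (x + y) ≤ matNorm V x + matNorm V y := by
  obtain ⟨B, -, h⟩ := exists_matNorm_eq hV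
  rw [h, h, h]
  refine le_of_eq_of_le ?_ (norm_add_le _ _)
  rw [WithLp.ofLp_add, mulVec_add, WithLp.toLp_add]

lemma matNorm_smul (hV : V.PosSemidef) (c : ℝ) (x : EuclideanSpace ℝ (Fin d)) :
    matNorm V (c • x) = |c| * matNorm V x := by
  obtain ⟨B, -, h⟩ := exists_matNorm_eq hV
  rw [h, h, ← Real.norm_eq_abs, ← norm_smul, WithLp.ofLp_smul, mulVec_smul, WithLp.toLp_smul]

lemma matNorm_inv_mulVec (hV : V.PosDef) (x : EuclideanSpace ℝ (Fin d)) :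
    matNorm V (WithLp.toLp 2 (V⁻¹ *ᵥ x.ofLp)) = matNorm V⁻¹ x := by
  simp only [matNorm]
  rw [mulVec_inv_mulVec hV, dotProduct_comm]

/-- With `V = BᵀB` one has `⟪θ, x⟫ = ⟪Bθ, B V⁻¹x⟫`, and `‖B V⁻¹x‖` is the `V⁻¹`-norm of `x`. -/
lemma abs_inner_le_matNorm (hV : V.PosDef) (θ x : EuclideanSpace ℝ (Fin d)) :
    |inner ℝ θ x| ≤ matNorm V θ * matNorm V⁻¹ x := by
  obtain ⟨B, hB, h⟩ := exists_matNorm_eq hV.posSemidef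
  rw [← matNorm_inv_mulVec hV, h, h]
  refine le_of_eq_of_le ?_ (abs_real_inner_le_norm _ _)
  congr 1
  rw [EuclideanSpace.inner_eq_star_dotProduct, EuclideanSpace.inner_eq_star_dotProduct]
  simp only [star_trivial]
  conv_lhs => rw [← mulVec_inv_mulVec hV x.ofLp]
  rw [hB, ← mulVec_mulVec, dotProduct_comm, dotProduct_mulVec, vecMul_transpose, dotProduct_comm]

lemma matNorm_sq (hV : V.PosSemidef) (x : EuclideanSpace ℝ (Fin d)) :
    matNorm V x ^ 2 = x.ofLp ⬝ᵥ V *ᵥ x.ofLp :=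
  Real.sq_sqrt (by simpa using hV.dotProduct_mulVec_nonneg x.ofLp)

/-- For `y = V⁻¹x` the squared `V⁻¹`-norm of `x` is `⟪y, x⟫ ≤ ‖y‖‖x‖`, while `V ≥ λI` gives `√λ ‖y‖
≤ ‖x‖_{V⁻¹}`; one factor cancels. -/
lemma matNorm_inv_le {lam : ℝ} (hlam : 0 < lam) (hV : V.PosDef)
    (hle : (V - lam • (1 : Matrix (Fin d) (Fin d) ℝ)).PosSemidef)
    (x : EuclideanSpace ℝ (Fin d)) : matNorm V⁻¹ x ≤ ‖x‖ / √lam := by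
  set y : EuclideanSpace ℝ (Fin d) := WithLp.toLp 2 (V⁻¹ *ᵥ x.ofLp) with hy
  have hsq : matNorm V⁻¹ x ^ 2 = inner ℝ y x := by
    rw [matNorm_sq hV.inv.posSemidef, EuclideanSpace.inner_eq_star_dotProduct]
    simp [hy]
  have h1 : lam * ‖y‖ ^ 2 ≤ matNorm V⁻¹ x ^ 2 := by
    rw [← matNorm_inv_mulVec hV, matNorm_sq hV.posSemidef]
    have h := hle.dotProduct_mulVec_nonneg y.ofLp
    simp only [star_trivial, sub_mulVec, smul_mulVec, one_mulVec, dotProduct_sub, dotProduct_smul,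
      smul_eq_mul] at h
    have : ‖y‖ ^ 2 = y.ofLp ⬝ᵥ y.ofLp := by
      rw [EuclideanSpace.real_norm_sq_eq]; simp [dotProduct, sq]
    rw [this]; linarith
  have h2 : inner ℝ y x ≤ ‖y‖ * ‖x‖ := real_inner_le_norm _ _
  have hs : 0 < √lam := Real.sqrt_pos.2 hlam
  have hss : √lam ^ 2 = lam := Real.sq_sqrt hlam.le
  have hm := matNorm_nonneg V⁻¹ x
  have h3 : √lam * ‖y‖ ≤ matNorm V⁻¹ x := by
    refine le_of_sq_le_sq ?_ hm
    rw [mul_pow, hss]; exact h1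
  rw [le_div_iff₀ hs]
  rcases hm.eq_or_lt with h0 | h0
  · rw [← h0]; simp
  · nlinarith [norm_nonneg x, norm_nonneg y]

/-- All eigenvalues are at least `lam` and their excesses over `lam` sum to at most `c`, so each is
at most `lam + c`. This is cruder than AM–GM but already gives the `d log(1 + n/λ)` that appears in
`beta`. -/
lemma det_le_pow_of_trace_le {lam c : ℝ}
    (hle : (V - lam • (1 : Matrix (Fin d) (Fin d) ℝ)).PosSemidef) (hlam : 0 ≤ lam)
    (htr : V.trace ≤ lam * d + c) : V.det ≤ (lam + c) ^ d := by
  have hH : V.IsHermitian := by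
    have : V = (V - lam • (1 : Matrix (Fin d) (Fin d) ℝ)) + lam • 1 := by simp
    rw [this]
    exact hle.isHermitian.add (isHermitian_one.smul (k := lam) (by simp [IsSelfAdjoint]))
  have hge : ∀ i, lam ≤ hH.eigenvalues i := by
    intro i
    have h := hle.dotProduct_mulVec_nonneg (hH.eigenvectorBasis i).ofLp
    have h1 : (hH.eigenvectorBasis i).ofLp ⬝ᵥ (hH.eigenvectorBasis i).ofLp = 1 := by
      have := hH.eigenvectorBasis.orthonormal.1 i
      have h2 : ‖hH.eigenvectorBasis i‖ ^ 2 = 1 := by rw [this]; simp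
      rw [EuclideanSpace.real_norm_sq_eq] at h2
      rw [← h2]; simp [dotProduct, sq]
    simp only [star_trivial, sub_mulVec, smul_mulVec, one_mulVec, dotProduct_sub, dotProduct_smul,
      smul_eq_mul, hH.mulVec_eigenvectorBasis, h1] at h
    linarith
  have hdet := hH.det_eq_prod_eigenvalues
  have htrace := hH.trace_eq_sum_eigenvalues
  simp only [RCLike.ofReal_real_eq_id, id] at hdet htrace
  rw [hdet]
  calc ∏ i, hH.eigenvalues i ≤ ∏ _i : Fin d, (lam + c) := by
        refine Finset.prod_le_prod (fun i _ => hlam.trans (hge i)) fun i _ => ?_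
        have h3 : ∑ j, (hH.eigenvalues j - lam) ≤ c := by
          rw [Finset.sum_sub_distrib, ← htrace]; simp; linarith
        have h4 := Finset.single_le_sum (f := fun j => hH.eigenvalues j - lam)
          (fun j _ => sub_nonneg.2 (hge j)) (Finset.mem_univ i)
        linarith
    _ = _ := by simp

end LinearAlgebra

/-! ### Exponential moments of sub-Gaussian noise. -/

section Subgaussian

open Real

variable {μ : Measure ℝ}

lemma lintegral_exp_mul_le (h : HasSubgaussianMGF (fun η : ℝ => η) 1 μ) (u : ℝ) :
    ∫⁻ y, ENNReal.ofReal (exp (u * y)) ∂μ ≤ ENNReal.ofReal (exp (u ^ 2 / 2)) := by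
  rw [← ofReal_integral_eq_lintegral_ofReal (h.integrable_exp_mul u)
    (Filter.Eventually.of_forall fun _ => (exp_pos _).le)]
  refine ENNReal.ofReal_le_ofReal ?_
  simpa [mgf] using h.mgf_le u

/-- Completing the square: the integrand is a multiple of the density of the Gaussian with mean
`b/(1-c)` and variance `c/(1-c)`. -/
lemma lintegral_exp_sq_gaussianReal (b : ℝ) {c : NNReal} (hc : c ≠ 0) (hc1 : c < 1) :
    ∫⁻ s, ENNReal.ofReal (exp (s ^ 2 / 2)) ∂(gaussianReal b c) =
      ENNReal.ofReal (exp (b ^ 2 / (2 * (1 - c))) / √(1 - c)) := by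
  have hc1' : (0 : ℝ) < 1 - c := sub_pos.2 (by exact_mod_cast hc1)
  have hc0 : (0 : ℝ) < c := by positivity
  set v : NNReal := c / (1 - c) with hv
  have hvr : (v : ℝ) = c / (1 - c) := by
    rw [hv, NNReal.coe_div, NNReal.coe_sub hc1.le]; simp
  have hv0 : v ≠ 0 := by
    have : (0 : ℝ) < v := by rw [hvr]; positivity
    exact_mod_cast this.ne'
  rw [gaussianReal_of_var_ne_zero _ hc,
    lintegral_withDensity_eq_lintegral_mul _ (measurable_gaussianPDF _ _) (by fun_prop)]
  have hpt : ∀ s : ℝ, (gaussianPDF b c * fun s => ENNReal.ofReal (exp (s ^ 2 / 2))) s =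
      ENNReal.ofReal (exp (b ^ 2 / (2 * (1 - c))) / √(1 - c)) * gaussianPDF (b / (1 - c)) v s := by
    intro s
    simp only [Pi.mul_apply, gaussianPDF]
    rw [← ENNReal.ofReal_mul (gaussianPDFReal_nonneg _ _ _), ← ENNReal.ofReal_mul (by positivity)]
    congr 1
    simp only [gaussianPDFReal, hvr]
    have e1 : √(2 * π * (c / (1 - c))) = √(2 * π * c) / √(1 - c) := by
      rw [← mul_div_assoc, sqrt_div (by positivity)]
    have hs : √(1 - (c : ℝ)) ≠ 0 := (sqrt_pos.2 hc1').ne'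
    have hs2 : √(2 * π * (c : ℝ)) ≠ 0 := (sqrt_pos.2 (by positivity)).ne'
    rw [e1, mul_assoc, ← exp_add]
    have e2 : -(s - b) ^ 2 / (2 * c) + s ^ 2 / 2 = b ^ 2 / (2 * (1 - c)) +
        -(s - b / (1 - c)) ^ 2 / (2 * (c / (1 - c))) := by
      field_simp
      ring
    rw [e2, exp_add]
    field_simp
  simp_rw [hpt]
  rw [lintegral_const_mul _ (measurable_gaussianPDF _ _), lintegral_gaussianPDF_eq_one _ hv0,
    mul_one]

/-- The moment generating function of `c y²/2 + b y` for a `1`-sub-Gaussian variable `y`. -/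
lemma lintegral_exp_quad_le [IsProbabilityMeasure μ]
    (h : HasSubgaussianMGF (fun η : ℝ => η) 1 μ) (b : ℝ) {c : NNReal} (hc1 : c < 1) :
    ∫⁻ y, ENNReal.ofReal (exp (c * y ^ 2 / 2 + b * y)) ∂μ ≤
      ENNReal.ofReal (exp (b ^ 2 / (2 * (1 - c))) / √(1 - c)) := by
  -- For `c = 0` the Gaussian below degenerates to a point mass without density, and the claim is
  -- the sub-Gaussian bound itself.
  rcases eq_or_ne c 0 with rfl | hc
  · simpa using lintegral_exp_mul_le h b
  -- The quadratic exponent is linearised: `exp(c y²/2 + b y)` is the moment generating function at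
  -- `y` of a Gaussian with mean `b` and variance `c`. After exchanging the integrals the
  -- sub-Gaussian bound applies for each fixed `s`.
  have hg : ∀ y : ℝ, ENNReal.ofReal (exp (c * y ^ 2 / 2 + b * y)) =
      ∫⁻ s, ENNReal.ofReal (exp (y * s)) ∂(gaussianReal b c) := by
    intro y
    have hi : Integrable (fun s => exp (y * s)) (gaussianReal b c) :=
      integrable_exp_mul_gaussianReal y
    rw [← ofReal_integral_eq_lintegral_ofReal hi
      (Filter.Eventually.of_forall fun _ => (exp_pos _).le)]
    have := congrFun (mgf_id_gaussianReal (μ := b) (v := c)) y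
    simp only [mgf, id] at this
    rw [this]
    ring_nf
  simp_rw [hg]
  rw [lintegral_lintegral_swap (by fun_prop)]
  rw [← lintegral_exp_sq_gaussianReal b hc hc1]
  refine lintegral_mono fun s => ?_
  have := lintegral_exp_mul_le h s
  simp_rw [mul_comm _ s]
  exact this

end Subgaussian

/-! ### Supermartingales and almost sure properties along the interaction. -/

section Law

variable {d K t : ℕ} (P : Params) (tie : TieBreak K) (E : Env d K) (σ : Fin K → Strategy d K)

/-- A bound on the reward integral that is uniform in the reports and the selection survives
averaging over them. This is why neither the strategies nor the tie-breaking affect the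
concentration bounds. -/
lemma lintegral_stepKernel_le {F : Round d K → ENNReal} (hF : Measurable F) (h : History d K t)
    {c : ENNReal} (hc : ∀ x a, ∫⁻ r, F (x, a, r) ∂(rewardMeasure E t h a) ≤ c) :
    ∫⁻ p, F p ∂(stepKernel P tie E σ t h) ≤ c := by
  rw [stepKernel, Kernel.lintegral_compProd _ _ _ hF]
  calc _ ≤ ∫⁻ _x, c ∂(reportKernel E σ t h) := by
        refine lintegral_mono fun x => ?_
        rw [Kernel.lintegral_compProd _ _ _ (by fun_prop)]
        calc _ ≤ ∫⁻ _a, c ∂(selectKernel P tie t (h, x)) :=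
              lintegral_mono fun a => hc x a
          _ = c := by simp
    _ = c := by simp

lemma ae_stepKernel {Q : Round d K → Prop} (h : History d K t)
    (hQm : MeasurableSet {p | Q p})
    (hQ : ∀ᵐ x ∂(reportKernel E σ t h), ∀ᵐ a ∂(selectKernel P tie t (h, x)), ∀ r, Q (x, a, r)) :
    ∀ᵐ p ∂(stepKernel P tie E σ t h), Q p := by
  rw [stepKernel, Kernel.ae_compProd_iff hQm]
  filter_upwards [hQ] with x hx
  rw [Kernel.ae_compProd_iff (p := fun c => Q (x, c)) (measurable_prodMk_left hQm)]
  filter_upwards [hx] with a ha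
  exact Filter.Eventually.of_forall ha

lemma lintegral_law_succ {F : History d K (t + 1) → ENNReal} (hF : Measurable F) :
    ∫⁻ h, F h ∂(law P tie E σ (t + 1)) =
      ∫⁻ h, ∫⁻ p, F (Fin.snoc (α := fun _ => Round d K) h p) ∂(stepKernel P tie E σ t h)
        ∂(law P tie E σ t) := by
  rw [law, lintegral_map hF measurable_snoc,
    Measure.lintegral_compProd (f := fun p => F (Fin.snoc (α := fun _ => Round d K) p.1 p.2))
      (hF.comp measurable_snoc)]

lemma before_self (h : History d K t) : h.before t le_rfl = h := rfl

lemma snoc_before (h : History d K t) (p : Round d K) {s : ℕ} (hs : s ≤ t) :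
    History.before (Fin.snoc (α := fun _ => Round d K) h p : History d K (t + 1)) s
      (hs.trans t.le_succ) = h.before s hs := by
  funext ℓ
  exact Fin.snoc_castSucc (α := fun _ => Round d K) p h (Fin.castLE hs ℓ)

lemma eq_snoc (h : History d K (t + 1)) :
    h = Fin.snoc (α := fun _ => Round d K) (h.before t t.le_succ) (h (Fin.last t)) :=
  (Fin.snoc_init_self (α := fun _ => Round d K) h).symm

lemma snoc_apply_of_lt (h : History d K t) (p : Round d K) (s : Fin t) :
    (Fin.snoc (α := fun _ => Round d K) h p : History d K (t + 1)) s.castSucc = h s :=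
  Fin.snoc_castSucc (α := fun _ => Round d K) p h s

/-- A maximal inequality for nonnegative supermartingales along the interaction. -/
lemma law_exists_one_le (W : ∀ t, History d K t → ENNReal) (hW : ∀ t, Measurable (W t)) (T : ℕ)
    (hstep : ∀ t < T, ∀ h : History d K t,
      ∫⁻ p, W (t + 1) (Fin.snoc (α := fun _ => Round d K) h p) ∂(stepKernel P tie E σ t h) ≤ W t h) :
    law P tie E σ T {h | ∃ s, ∃ hs : s ≤ T, 1 ≤ W s (h.before s hs)} ≤ W 0 Fin.elim0 := by
  classical
  set A : ∀ t, Set (History d K t) :=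
    fun t => {h | ∃ s, ∃ hs : s ≤ t, 1 ≤ W s (h.before s hs)} with hA
  have hAm : ∀ t, MeasurableSet (A t) := by
    intro t
    have : A t = ⋃ s : ℕ, ⋃ hs : s ≤ t, (fun h => h.before s hs) ⁻¹' {h | 1 ≤ W s h} := by
      ext h; simp [hA]
    rw [this]
    exact MeasurableSet.iUnion fun s => MeasurableSet.iUnion fun hs =>
      measurable_before s hs (measurableSet_le measurable_const (hW s))
  -- Ville's inequality by stopping: the process is frozen at the value `1` once it has reached `1`.
  -- It remains a supermartingale and dominates the indicator of the event.
  set G : ∀ t, History d K t → ENNReal := fun t h => if h ∈ A t then 1 else W t h with hG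
  have hGm : ∀ t, Measurable (G t) := fun t => Measurable.ite (hAm t) measurable_const (hW t)
  have main : ∀ t ≤ T, ∫⁻ h, G t h ∂(law P tie E σ t) ≤ W 0 Fin.elim0 := by
    intro t
    induction t with
    | zero =>
      intro _
      rw [law, lintegral_dirac' _ (hGm 0)]
      simp only [hG]
      split_ifs with h0
      · obtain ⟨s, hs, h1⟩ := h0
        obtain rfl : s = 0 := by omega
        exact h1
      · exact le_rfl
    | succ t ih =>
      intro ht
      refine le_trans ?_ (ih (by omega))
      rw [lintegral_law_succ _ _ _ _ (hGm _)]
      refine lintegral_mono fun h => ?_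
      by_cases hh : h ∈ A t
      · have h1 : ∀ p, G (t + 1) (Fin.snoc (α := fun _ => Round d K) h p) = 1 := by
          intro p
          obtain ⟨s, hs, h1⟩ := hh
          simp only [hG]
          rw [if_pos]
          exact ⟨s, hs.trans t.le_succ, by rwa [snoc_before]⟩
        simp only [h1, lintegral_const, measure_univ, one_mul]
        simp [hG, if_pos hh]
      · have h1 : ∀ p, G (t + 1) (Fin.snoc (α := fun _ => Round d K) h p) ≤
            W (t + 1) (Fin.snoc (α := fun _ => Round d K) h p) := by
          intro p
          simp only [hG]
          split_ifs with hp
          · obtain ⟨s, hs, h1⟩ := hp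
            rcases hs.lt_or_eq with hs' | rfl
            · refine absurd ⟨s, Nat.lt_succ_iff.1 hs', ?_⟩ hh
              rwa [snoc_before _ _ (Nat.lt_succ_iff.1 hs')] at h1
            · exact h1
          · exact le_rfl
        refine (lintegral_mono h1).trans ((hstep t ht h).trans ?_)
        simp only [hG, if_neg hh]; exact le_rfl
  refine le_trans ?_ (main T le_rfl)
  rw [← lintegral_indicator_one (hAm T)]
  refine lintegral_mono fun h => ?_
  by_cases hh : h ∈ A T <;> simp [hG, hh]

lemma ae_law_of_ae_step (Q : ∀ t, History d K t → Round d K → Prop) (T : ℕ)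
    (hQm : ∀ t, MeasurableSet {p : History d K t × Round d K | Q t p.1 p.2})
    (hQ : ∀ t < T, ∀ h, ∀ᵐ p ∂(stepKernel P tie E σ t h), Q t h p) :
    ∀ᵐ h ∂(law P tie E σ T), ∀ s : Fin T, Q s (h.before s s.2.le) (h s) := by
  have hm : ∀ t, MeasurableSet
      {h : History d K t | ∀ s : Fin t, Q s (h.before s s.2.le) (h s)} := by
    intro t
    rw [Set.ofPred_forall]
    exact MeasurableSet.iInter fun s =>
      ((measurable_before _ _).prodMk (measurable_pi_apply s)) (hQm s)
  have main : ∀ t ≤ T, ∀ᵐ h ∂(law P tie E σ t), ∀ s : Fin t, Q s (h.before s s.2.le) (h s) := by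
    intro t
    induction t with
    | zero => intro _; exact Filter.Eventually.of_forall fun h s => s.elim0
    | succ t ih =>
      intro ht
      rw [law, ae_map_iff measurable_snoc.aemeasurable (hm _)]
      refine Measure.ae_compProd_of_ae_ae (measurable_snoc (hm _)) ?_
      filter_upwards [ih (by omega)] with h hh
      filter_upwards [hQ t ht h] with p hp
      intro s
      induction s using Fin.lastCases with
      | last =>
        have := snoc_before h p le_rfl
        simpa [Fin.snoc_last, this, before_self] using hp
      | cast s =>
        have h1 := snoc_before h p s.2.le
        rw [snoc_apply_of_lt]
        simp only [Fin.val_castSucc]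
        rw [h1]
        exact hh s
  exact main T le_rfl

end Law

/-! ### Noise statistics of an arm and their one-round updates. -/

variable {d K t : ℕ}

/-- The total noise `∑_{ℓ < t, i_ℓ = i} η_ℓ` in the rewards of arm `i`. -/
noncomputable def noiseSum (E : Env d K) (h : History d K t) (i : Fin K) : ℝ :=
  ∑ ℓ : Fin t, if h.arm ℓ = some i then h.reward ℓ - E.mean ℓ i else 0

/-- The noise weighted by the reports, `∑_{ℓ < t, i_ℓ = i} η_ℓ x_{ℓ,i}`. -/
noncomputable def noiseVec (E : Env d K) (h : History d K t) (i : Fin K) : Fin d → ℝ :=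
  ∑ ℓ : Fin t, if h.arm ℓ = some i then
    (h.reward ℓ - E.mean ℓ i) • (h.report ℓ i).ofLp else 0

/-- The squared norm `‖∑ η_ℓ x_ℓ‖²` with respect to `V_{t,i}⁻¹`. -/
noncomputable def noiseQuad (P : Params) (E : Env d K) (h : History d K t) (i : Fin K) : ℝ :=
  noiseVec E h i ⬝ᵥ Matrix.mulVec (gram P h i)⁻¹ (noiseVec E h i)

section Snoc

/-- A history extended by one round. -/
def History.extend (h : History d K t) (p : Round d K) : History d K (t + 1) :=
  Fin.snoc (α := fun _ => Round d K) h p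

variable (P : Params) (E : Env d K) (h : History d K t) (i : Fin K) (p : Round d K)

@[simp] lemma extend_castSucc (ℓ : Fin t) : h.extend p ℓ.castSucc = h ℓ :=
  Fin.snoc_castSucc (α := fun _ => Round d K) p h ℓ

@[simp] lemma extend_last : h.extend p (Fin.last t) = p :=
  Fin.snoc_last (α := fun _ => Round d K) p h

@[simp] lemma arm_extend_castSucc (ℓ : Fin t) : (h.extend p).arm ℓ.castSucc = h.arm ℓ := by
  simp [History.arm]

@[simp] lemma reward_extend_castSucc (ℓ : Fin t) :
    (h.extend p).reward ℓ.castSucc = h.reward ℓ := by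
  simp [History.reward]

@[simp] lemma report_extend_castSucc (ℓ : Fin t) :
    (h.extend p).report ℓ.castSucc i = h.report ℓ i := by
  simp [History.report]

@[simp] lemma arm_extend_last : (h.extend p).arm (Fin.last t) = p.2.1 := by
  simp [History.arm]

@[simp] lemma reward_extend_last : (h.extend p).reward (Fin.last t) = p.2.2 := by
  simp [History.reward]

@[simp] lemma report_extend_last : (h.extend p).report (Fin.last t) i = p.1 i := by
  simp [History.report]

lemma extend_before {s : ℕ} (hs : s ≤ t) :
    (h.extend p).before s (hs.trans t.le_succ) = h.before s hs := snoc_before h p hs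

lemma eq_extend (h : History d K (t + 1)) :
    h = (h.before t t.le_succ).extend (h (Fin.last t)) := eq_snoc h

lemma gram_extend : gram P (h.extend p) i = gram P h i +
    if p.2.1 = some i then Matrix.vecMulVec (p.1 i).1.ofLp (p.1 i).1.ofLp else 0 := by
  simp [gram, Fin.sum_univ_castSucc, add_assoc]

lemma noiseSum_extend : noiseSum E (h.extend p) i = noiseSum E h i +
    if p.2.1 = some i then p.2.2 - E.mean t i else 0 := by
  simp [noiseSum, Fin.sum_univ_castSucc]

lemma noiseVec_extend : noiseVec E (h.extend p) i = noiseVec E h i +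
    if p.2.1 = some i then (p.2.2 - E.mean t i) • (p.1 i).1.ofLp else 0 := by
  simp [noiseVec, Fin.sum_univ_castSucc]

lemma numPulls_extend : (h.extend p).numPulls i = h.numPulls i +
    if p.2.1 = some i then 1 else 0 := by
  rw [History.numPulls, Finset.card_filter, Fin.sum_univ_castSucc, History.numPulls,
    Finset.card_filter]
  simp only [arm_extend_castSucc, arm_extend_last]

end Snoc

/-! ### Spectral bounds for the Gram matrix. -/

section Gram

variable {P : Params}

lemma norm_ctx_le (x : Ctx d) : ‖(x : EuclideanSpace ℝ (Fin d))‖ ≤ 1 :=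
  mem_closedBall_zero_iff.1 x.2

lemma gram_sub_posSemidef (P : Params) (h : History d K t) (i : Fin K) :
    (gram P h i - P.lam • (1 : Matrix (Fin d) (Fin d) ℝ)).PosSemidef := by
  rw [gram, add_sub_cancel_left]
  refine Matrix.posSemidef_sum _ fun ℓ _ => ?_
  split_ifs
  · simpa using Matrix.posSemidef_vecMulVec_self_star (h.report ℓ i).ofLp
  · exact Matrix.PosSemidef.zero

lemma gram_posDef (hlam : 0 < P.lam) (h : History d K t) (i : Fin K) : (gram P h i).PosDef := by
  have h1 : (P.lam • (1 : Matrix (Fin d) (Fin d) ℝ)).PosDef := Matrix.PosDef.one.smul hlam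
  simpa using h1.add_posSemidef (gram_sub_posSemidef P h i)

lemma trace_gram_le (P : Params) (h : History d K t) (i : Fin K) :
    (gram P h i).trace ≤ P.lam * d + h.numPulls i := by
  simp only [gram, Matrix.trace_add, Matrix.trace_smul, Matrix.trace_one, Fintype.card_fin,
    smul_eq_mul, Matrix.trace_sum, History.numPulls, Finset.card_filter, Nat.cast_sum]
  gcongr with ℓ
  split_ifs
  · rw [Matrix.trace_vecMulVec]
    have h1 := norm_ctx_le ((h ℓ).1 i)
    have h2 : ‖h.report ℓ i‖ ^ 2 = (h.report ℓ i).ofLp ⬝ᵥ (h.report ℓ i).ofLp := by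
      rw [EuclideanSpace.real_norm_sq_eq]; simp [dotProduct, sq]
    rw [← h2, Nat.cast_one]
    exact pow_le_one₀ (norm_nonneg _) h1
  · simp

lemma log_det_gram_le (hlam : 0 < P.lam) (h : History d K t) (i : Fin K) :
    Real.log ((gram P h i).det / P.lam ^ d) ≤ d * Real.log (1 + h.numPulls i / P.lam) := by
  have h1 := det_le_pow_of_trace_le (gram_sub_posSemidef P h i) hlam.le (trace_gram_le P h i)
  have h2 := (gram_posDef hlam h i).det_pos
  rw [← Real.log_pow]
  refine Real.log_le_log (by positivity) ?_
  rw [div_le_iff₀ (by positivity), ← mul_pow]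
  refine h1.trans_eq ?_
  congr 1
  field_simp

end Gram

/-! ### Measurability of the noise statistics. -/

section Measurability

lemma measurable_noiseSum (E : Env d K) (i : Fin K) :
    Measurable fun h : History d K t => noiseSum E h i := by
  unfold noiseSum
  refine Finset.measurable_sum _ fun ℓ _ => ?_
  exact Measurable.ite (measurableSet_arm ℓ _) ((measurable_reward ℓ).sub_const _) measurable_const

lemma measurable_noiseVec (E : Env d K) (i : Fin K) (k : Fin d) :
    Measurable fun h : History d K t => noiseVec E h i k := by
  simp only [noiseVec, Finset.sum_apply]
  refine Finset.measurable_sum _ fun ℓ _ => ?_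
  have : (fun h : History d K t => (if h.arm ℓ = some i then
      (h.reward ℓ - E.mean ℓ i) • (h.report ℓ i).ofLp else 0) k) =
      fun h => if h.arm ℓ = some i then (h.reward ℓ - E.mean ℓ i) * (h.report ℓ i) k else 0 := by
    funext h; split_ifs <;> simp
  rw [this]
  have hr := measurable_report (d := d) ℓ i
  have hw := measurable_reward (d := d) (K := K) ℓ
  exact Measurable.ite (measurableSet_arm ℓ _) (by fun_prop) measurable_const

lemma measurable_noiseQuad (P : Params) (E : Env d K) (i : Fin K) :
    Measurable fun h : History d K t => noiseQuad P E h i := by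
  simp only [noiseQuad, dotProduct, Matrix.mulVec]
  exact Finset.measurable_sum _ fun a _ => (measurable_noiseVec E i a).mul
    (Finset.measurable_sum _ fun b _ =>
      (measurable_inv (measurable_gram P i) a b).mul (measurable_noiseVec E i b))

end Measurability

/-! ### Self-normalised and scalar concentration. -/

section Supermartingales

open Real

variable {P : Params} {tie : TieBreak K} {E : Env d K} {σ : Fin K → Strategy d K} {S : ℝ} {T : ℕ}

/-- Statistics of arm `i` do not change when another arm, or none, is played, so only the noise of
arm `i` has to be integrated. -/
lemma lintegral_rewardMeasure_le (h : History d K t) (i : Fin K) {F : Option (Fin K) → ℝ → ENNReal}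
    (hF : ∀ a, Measurable (F a)) {c : ENNReal} (hne : ∀ a ≠ some i, ∀ r, F a r ≤ c)
    (hi : ∫⁻ η, F (some i) (E.mean t i + η) ∂(E.noise t i h) ≤ c) (a : Option (Fin K)) :
    ∫⁻ r, F a r ∂(rewardMeasure E t h a) ≤ c := by
  by_cases ha : a = some i
  · subst ha
    change ∫⁻ r, F (some i) r ∂((E.noise t i h).map fun η => E.mean t i + η) ≤ c
    rwa [lintegral_map (hF _) (measurable_const_add _)]
  · have hp : IsProbabilityMeasure (rewardMeasure E t h a) :=
      (instMarkovReward E t).isProbabilityMeasure (h, a)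
    calc _ ≤ ∫⁻ _r, c ∂(rewardMeasure E t h a) := lintegral_mono fun r => hne a ha r
      _ = c := by simp

/-- The self-normalised supermartingale of arm `i`. -/
noncomputable def selfNormalized (P : Params) (E : Env d K) (i : Fin K) (t : ℕ)
    (h : History d K t) : ENNReal :=
  ENNReal.ofReal (exp (noiseQuad P E h i / 2) / √((gram P h i).det / P.lam ^ d) / P.T)

lemma measurable_selfNormalized (P : Params) (E : Env d K) (i : Fin K) (t : ℕ) :
    Measurable (selfNormalized P E i t) := by
  have h1 := measurable_noiseQuad (t := t) P E i
  have h2 : Measurable fun h : History d K t => (gram P h i).det :=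
    measurable_det (measurable_gram P i)
  unfold selfNormalized
  fun_prop

/-- The rank-one update makes the exponent quadratic in the new noise `η`, and the determinant
contributes `1/√(1 + α)`. Integrating out `η` by `lintegral_exp_quad_le` gives factors that cancel
both exactly, so no Gaussian mixture over `ℝ^d` is needed. -/
lemma selfNormalized_step (hlam : 0 < P.lam) {i : Fin K} {h : History d K t}
    (hsub : HasSubgaussianMGF (fun η : ℝ => η) 1 (E.noise t i h)) :
    ∫⁻ p, selfNormalized P E i (t + 1) (h.extend p) ∂(stepKernel P tie E σ t h) ≤
      selfNormalized P E i t h := by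
  have hm : Measurable fun p => selfNormalized P E i (t + 1) (h.extend p) :=
    (measurable_selfNormalized P E i (t + 1)).comp (measurable_snoc.comp measurable_prodMk_left)
  refine lintegral_stepKernel_le P tie E σ hm h fun x a => ?_
  refine lintegral_rewardMeasure_le h i
    (F := fun a r => selfNormalized P E i (t + 1) (h.extend (x, a, r)))
    (fun a => hm.comp (by fun_prop)) (fun a ha r => ?_) ?_ a
  · simp [selfNormalized, noiseQuad, noiseVec_extend, gram_extend, ha]
  have hpr : IsProbabilityMeasure (E.noise t i h) := (E.noise_markov t i).isProbabilityMeasure h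
  have hV := gram_posDef hlam h i
  have hx := inv_quadForm_nonneg hV (x i).1.ofLp
  set V := gram P h i with hVdef
  set α := (x i).1.ofLp ⬝ᵥ Matrix.mulVec V⁻¹ (x i).1.ofLp with hα
  set b := (x i).1.ofLp ⬝ᵥ Matrix.mulVec V⁻¹ (noiseVec E h i) with hb
  -- This is the coefficient of `η²/2` after the update; `1 - c = 1/(1 + α)` produces the
  -- cancellation.
  set c : NNReal := ⟨α / (1 + α), by positivity⟩ with hc
  have hcr : (c : ℝ) = α / (1 + α) := rfl
  have hc1r : 1 - (c : ℝ) = 1 / (1 + α) := by rw [hcr]; field_simp; ring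
  have hc1 : c < 1 := by
    have : (0 : ℝ) < 1 - c := by rw [hc1r]; positivity
    exact_mod_cast sub_pos.1 this
  have hdet := hV.det_pos
  set w := exp (noiseQuad P E h i / 2) / √(V.det / P.lam ^ d) / P.T with hw
  have hw0 : 0 ≤ w := by positivity
  have hpt : ∀ η : ℝ, selfNormalized P E i (t + 1) (h.extend (x, some i, E.mean t i + η)) =
      ENNReal.ofReal (w * (exp (-(b ^ 2 / (2 * (1 + α)))) / √(1 + α))) *
        ENNReal.ofReal (exp (c * η ^ 2 / 2 + b / (1 + α) * η)) := by
    intro η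
    rw [← ENNReal.ofReal_mul (by positivity)]
    simp only [selfNormalized, noiseQuad, noiseVec_extend, gram_extend, if_true,
      add_sub_cancel_left]
    rw [quadForm_update hV, det_add_vecMulVec_self hV, ← hα, ← hb,
      mul_div_right_comm V.det, sqrt_mul (by positivity)]
    congr 1
    have e : (noiseVec E h i ⬝ᵥ Matrix.mulVec V⁻¹ (noiseVec E h i) +
        (2 * η * b + η ^ 2 * α - b ^ 2) / (1 + α)) / 2 = noiseQuad P E h i / 2 +
        (-(b ^ 2 / (2 * (1 + α))) + (c * η ^ 2 / 2 + b / (1 + α) * η)) := by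
      rw [hcr, noiseQuad, ← hVdef]
      field_simp
      ring
    rw [e, exp_add, exp_add, hw]
    field_simp
  simp_rw [hpt]
  rw [lintegral_const_mul _ (by fun_prop)]
  refine (mul_le_mul_right (lintegral_exp_quad_le hsub _ hc1) _).trans ?_
  rw [← ENNReal.ofReal_mul (by positivity)]
  refine ENNReal.ofReal_le_ofReal (le_of_eq ?_)
  have h1 : √(1 - (c : ℝ)) = 1 / √(1 + α) := by rw [hc1r, sqrt_div zero_le_one, sqrt_one]
  have h2 : (b / (1 + α)) ^ 2 / (2 * (1 - c)) = b ^ 2 / (2 * (1 + α)) := by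
    rw [hc1r]; field_simp
  rw [h1, h2]
  have h3 : √(1 + α) ≠ 0 := (sqrt_pos.2 (by positivity)).ne'
  have h4 : exp (-(b ^ 2 / (2 * (1 + α)))) * exp (b ^ 2 / (2 * (1 + α))) = 1 := by
    rw [← exp_add]; simp
  calc _ = w * (exp (-(b ^ 2 / (2 * (1 + α)))) * exp (b ^ 2 / (2 * (1 + α)))) := by
        field_simp
    _ = w := by rw [h4, mul_one]

/-- The event that the ridge estimator of arm `i` is within its confidence width, up to the bias. -/
def Covered (P : Params) (E : Env d K) (h : History d K T) (i : Fin K) : Prop :=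
  ∀ s, ∀ hs : s ≤ T, noiseQuad P E (h.before s hs) i ≤
    d * log ((1 + (h.before s hs).numPulls i / P.lam) / (1 / (P.T : ℝ) ^ 2))

/-- Since `log(det V / λ^d) ≤ d log(1 + n/λ)` and `d ≥ 1`, a violation forces `noiseQuad > log(det V
/ λ^d) + 2 log T`, so `selfNormalized` reaches `1`; it starts at `1/T`. The level `δ = 1/T²` yields
only `1/T` because the exponent is half of `noiseQuad`. -/
lemma law_not_covered_le (hlam : 0 < P.lam) (hT : 2 ≤ P.T) (hd : 1 ≤ d) (hE : E.Regular S P.T)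
    (i : Fin K) :
    law P tie E σ P.T {h | ¬ Covered P E h i} ≤ ENNReal.ofReal (1 / P.T) := by
  have hV := law_exists_one_le P tie E σ (selfNormalized P E i) (measurable_selfNormalized P E i)
    P.T (fun t ht h => selfNormalized_step hlam (hE.subgaussian t ht i h))
  have hT0 : (0 : ℝ) < P.T := by positivity
  refine (measure_mono ?_).trans (hV.trans (le_of_eq ?_))
  · intro h hh
    simp only [Covered, not_forall, not_le, Set.mem_ofPred_eq] at hh
    obtain ⟨s, hs, hlt⟩ := hh
    refine ⟨s, hs, ?_⟩
    set g := h.before s hs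
    have hdet := (gram_posDef hlam g i).det_pos
    have hld := log_det_gram_le hlam g i
    rw [selfNormalized, ENNReal.one_le_ofReal, le_div_iff₀ hT0, one_mul,
      le_div_iff₀ (sqrt_pos.2 (by positivity)), ← log_le_iff_le_exp (by positivity),
      log_mul (by positivity) (sqrt_pos.2 (by positivity)).ne', log_sqrt (by positivity)]
    have hn : (0 : ℝ) < 1 + g.numPulls i / P.lam := by positivity
    rw [log_div hn.ne' (by positivity), log_div one_ne_zero (by positivity), log_one, log_pow] at hlt
    have hd' : (1 : ℝ) ≤ d := by exact_mod_cast hd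
    have hlT : 0 ≤ log P.T := log_nonneg (by exact_mod_cast (by omega : 1 ≤ P.T))
    push_cast at hlt
    nlinarith
  · simp [selfNormalized, noiseQuad, noiseVec, gram, hlam.ne']

/-- The exponential supermartingale of the noise in the rewards of arm `i`. -/
noncomputable def expNoise (P : Params) (E : Env d K) (i : Fin K) (u : ℝ) (t : ℕ)
    (h : History d K t) : ENNReal :=
  ENNReal.ofReal (exp (u * noiseSum E h i - u ^ 2 * h.numPulls i / 2) / (P.T : ℝ) ^ 2)

lemma measurable_expNoise (P : Params) (E : Env d K) (i : Fin K) (u : ℝ) (t : ℕ) :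
    Measurable (expNoise P E i u t) := by
  have h1 := measurable_noiseSum (t := t) E i
  have h2 := measurable_numPulls (d := d) (t := t) i
  unfold expNoise
  fun_prop

lemma expNoise_step {i : Fin K} {h : History d K t}
    (hsub : HasSubgaussianMGF (fun η : ℝ => η) 1 (E.noise t i h)) (u : ℝ) :
    ∫⁻ p, expNoise P E i u (t + 1) (h.extend p) ∂(stepKernel P tie E σ t h) ≤
      expNoise P E i u t h := by
  have hm : Measurable fun p => expNoise P E i u (t + 1) (h.extend p) :=
    (measurable_expNoise P E i u (t + 1)).comp (measurable_snoc.comp measurable_prodMk_left)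
  refine lintegral_stepKernel_le P tie E σ hm h fun x a => ?_
  refine lintegral_rewardMeasure_le h i
    (F := fun a r => expNoise P E i u (t + 1) (h.extend (x, a, r)))
    (fun a => hm.comp (by fun_prop)) (fun a ha r => ?_) ?_ a
  · simp [expNoise, noiseSum_extend, numPulls_extend, ha]
  set w := exp (u * noiseSum E h i - u ^ 2 * h.numPulls i / 2) / (P.T : ℝ) ^ 2 with hw
  have hpt : ∀ η : ℝ, expNoise P E i u (t + 1) (h.extend (x, some i, E.mean t i + η)) =
      ENNReal.ofReal (w * exp (-(u ^ 2 / 2))) * ENNReal.ofReal (exp (u * η)) := by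
    intro η
    rw [← ENNReal.ofReal_mul (by positivity)]
    simp only [expNoise, noiseSum_extend, numPulls_extend, if_true, add_sub_cancel_left]
    congr 1
    have e : u * (noiseSum E h i + η) - u ^ 2 * ((h.numPulls i + 1 : ℕ) : ℝ) / 2 =
        u * noiseSum E h i - u ^ 2 * h.numPulls i / 2 + (-(u ^ 2 / 2) + u * η) := by
      push_cast; ring
    rw [e, exp_add, exp_add, hw]
    ring
  simp_rw [hpt]
  rw [lintegral_const_mul _ (by fun_prop)]
  refine (mul_le_mul_right (lintegral_exp_mul_le hsub _) _).trans ?_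
  rw [← ENNReal.ofReal_mul (by positivity), mul_assoc, ← exp_add]
  simp [expNoise, hw]

/-- The event that `c` times the noise of arm `i` obeys the upper deviation bound of the grim
trigger. -/
def Concentrated (P : Params) (E : Env d K) (c : ℝ) (h : History d K T) (i : Fin K) : Prop :=
  ∀ s, ∀ hs : s ≤ T, c * noiseSum E (h.before s hs) i ≤
    2 * √((h.before s hs).numPulls i * log P.T)

lemma numPulls_le (h : History d K t) (i : Fin K) : h.numPulls i ≤ t := by
  simpa [History.numPulls] using
    Finset.card_filter_le (Finset.univ : Finset (Fin t)) (fun ℓ => h.arm ℓ = some i)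

lemma noiseSum_eq_zero {h : History d K t} {i : Fin K} (h0 : h.numPulls i = 0) :
    noiseSum E h i = 0 := by
  simp only [History.numPulls, Finset.card_eq_zero, Finset.filter_eq_empty_iff] at h0
  exact Finset.sum_eq_zero fun ℓ _ => if_neg (h0 (Finset.mem_univ ℓ))

/-- The best exponential tilt depends on the random number of pulls. A union bound over its values
`m = 1, …, T`, each with its own tilt and failure probability `1/T²`, gives `1/T`. -/
lemma law_not_concentrated_le (hT : 2 ≤ P.T) (hE : E.Regular S P.T) {c : ℝ} (hc : c ^ 2 = 1)
    (i : Fin K) :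
    law P tie E σ P.T {h | ¬ Concentrated P E c h i} ≤ ENNReal.ofReal (1 / P.T) := by
  have hT0 : (0 : ℝ) < P.T := by positivity
  have hT1 : (1 : ℝ) < P.T := by exact_mod_cast (by omega : 1 < P.T)
  have hL : 0 < log P.T := log_pos hT1
  -- For a deviation `a = 2√(m log T)` this maximises `|u| a - u² m/2`, with value `4 log T - 2 log
  -- T = log(T²)`. The sign `c` selects the tail.
  let u : ℕ → ℝ := fun m => c * (2 * √(log P.T / m))
  let B : ℕ → Set (History d K P.T) := fun m =>
    {h | ∃ s, ∃ hs : s ≤ P.T, 1 ≤ expNoise P E i (u m) s (h.before s hs)}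
  have hB : ∀ m, law P tie E σ P.T (B m) ≤ ENNReal.ofReal (1 / P.T ^ 2) := fun m => by
    refine (law_exists_one_le P tie E σ (expNoise P E i (u m)) (measurable_expNoise P E i _)
      P.T (fun t ht h => expNoise_step (hE.subgaussian t ht i h) _)).trans (le_of_eq ?_)
    simp [expNoise, noiseSum, History.numPulls]
  have hsub : {h | ¬ Concentrated P E c h i} ⊆ ⋃ m ∈ Finset.Icc 1 P.T, B m := by
    intro h hh
    simp only [Concentrated, not_forall, not_le, Set.mem_ofPred_eq] at hh
    obtain ⟨s, hs, hlt⟩ := hh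
    set g := h.before s hs with hg
    have hm0 : g.numPulls i ≠ 0 := by
      intro h0
      rw [noiseSum_eq_zero h0, mul_zero] at hlt
      exact absurd hlt (not_lt.2 (by positivity))
    simp only [Set.mem_iUnion]
    refine ⟨g.numPulls i, Finset.mem_Icc.2 ⟨Nat.one_le_iff_ne_zero.2 hm0,
      (numPulls_le g i).trans hs⟩, s, hs, ?_⟩
    rw [← hg, expNoise, ENNReal.one_le_ofReal, le_div_iff₀ (by positivity), one_mul,
      ← log_le_iff_le_exp (by positivity), log_pow]
    set m : ℝ := (g.numPulls i : ℝ) with hm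
    have hmpos : 0 < m := by positivity
    have e1 : √(log P.T / m) ^ 2 = log P.T / m := sq_sqrt (by positivity)
    have e2 : √(log P.T / m) * √(m * log P.T) = log P.T := by
      rw [← sqrt_mul (by positivity)]
      rw [show log P.T / m * (m * log P.T) = log P.T ^ 2 by field_simp]
      exact sqrt_sq hL.le
    have e3 : u (g.numPulls i) ^ 2 * m / 2 = 2 * log P.T := by
      simp only [u]
      rw [mul_pow, mul_pow, hc, ← hm, e1]
      field_simp
    have e4 : 4 * log P.T ≤ u (g.numPulls i) * noiseSum E g i := by
      simp only [u]
      rw [← hm]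
      calc 4 * log P.T = 2 * √(log P.T / m) * (2 * √(m * log P.T)) := by
            linear_combination (-4) * e2
        _ ≤ 2 * √(log P.T / m) * (c * noiseSum E g i) :=
            mul_le_mul_of_nonneg_left hlt.le (by positivity)
        _ = _ := by ring
    rw [e3]
    push_cast
    linarith
  calc _ ≤ ∑ m ∈ Finset.Icc 1 P.T, law P tie E σ P.T (B m) :=
        (measure_mono hsub).trans (measure_biUnion_finset_le _ _)
    _ ≤ ∑ _m ∈ Finset.Icc 1 P.T, ENNReal.ofReal (1 / P.T ^ 2) := Finset.sum_le_sum fun m _ => hB m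
    _ = ENNReal.ofReal (1 / P.T) := by
        rw [Finset.sum_const, Nat.card_Icc, Nat.add_sub_cancel, nsmul_eq_mul,
          ← ENNReal.ofReal_natCast, ← ENNReal.ofReal_mul hT0.le]
        congr 1
        field_simp

end Supermartingales

/-! ### Confidence widths and the elliptical potential. -/

variable {d K t T : ℕ} {P : Params} {E : Env d K}

/-- The half-width `√β_{ℓ,i} ‖x_{ℓ,i}‖_{V_{ℓ,i}⁻¹}` of the confidence interval of arm `i` for its
report in round `ℓ`. -/
noncomputable def width (P : Params) (h : History d K t) (i : Fin K) (ℓ : Fin t) : ℝ :=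
  √(beta P (h.before ℓ ℓ.2.le) i) * matNorm (gram P (h.before ℓ ℓ.2.le) i)⁻¹ (h.report ℓ i)

section Elliptical

/-- Each pull with squared norm `α` adds `log(1 + α) ≥ α/(1 + α)` to `log det`. Since `V ≥ λI` and
reports have norm at most one, `α ≤ 1/λ`, which costs the factor `1 + 1/λ`. -/
lemma sum_sq_matNorm_le_log_det (hlam : 0 < P.lam) (h : History d K t) (i : Fin K) :
    (∑ ℓ : Fin t, if h.arm ℓ = some i then
      matNorm (gram P (h.before ℓ ℓ.2.le) i)⁻¹ (h.report ℓ i) ^ 2 else 0) ≤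
      (1 + 1 / P.lam) * Real.log ((gram P h i).det / P.lam ^ d) := by
  induction t with
  | zero => simp [gram, hlam.ne']
  | succ t ih =>
    obtain ⟨g, p, rfl⟩ : ∃ g : History d K t, ∃ p, h = g.extend p := ⟨_, _, eq_extend h⟩
    have hb : ∀ ℓ : Fin t, (g.extend p).before (ℓ.castSucc : Fin (t + 1)) ℓ.castSucc.2.le =
        g.before ℓ ℓ.2.le := fun ℓ => extend_before g p ℓ.2.le
    have hl : (g.extend p).before (Fin.last t : Fin (t + 1)) (Fin.last t).2.le = g :=
      extend_before g p le_rfl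
    have hV := gram_posDef hlam g i
    rw [Fin.sum_univ_castSucc]
    simp only [arm_extend_castSucc, report_extend_castSucc, arm_extend_last, report_extend_last]
    rw [Finset.sum_congr rfl (g := fun ℓ : Fin t => if g.arm ℓ = some i then
      matNorm (gram P (g.before ℓ ℓ.2.le) i)⁻¹ (g.report ℓ i) ^ 2 else 0)
      (fun ℓ _ => by rw [hb])]
    rw [hl, gram_extend]
    split_ifs with ha
    · have hdet := hV.det_pos
      rw [det_add_vecMulVec_self hV, matNorm_sq hV.inv.posSemidef]
      set x : EuclideanSpace ℝ (Fin d) := (p.1 i).1 with hx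
      set α := x.ofLp ⬝ᵥ Matrix.mulVec (gram P g i)⁻¹ x.ofLp with hα
      have hα0 : 0 ≤ α := inv_quadForm_nonneg hV x.ofLp
      have hα1 : α ≤ 1 / P.lam := by
        rw [hα, ← matNorm_sq hV.inv.posSemidef]
        have h1 := matNorm_inv_le hlam hV (gram_sub_posSemidef P g i) x
        have h2 : ‖x‖ ≤ 1 := norm_ctx_le (p.1 i)
        calc _ ≤ (1 / √P.lam) ^ 2 := by
              refine pow_le_pow_left₀ (matNorm_nonneg _ _) (h1.trans ?_) 2
              gcongr
          _ = 1 / P.lam := by rw [div_pow, Real.sq_sqrt hlam.le, one_pow]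
      rw [mul_div_right_comm, Real.log_mul (by positivity) (by positivity), mul_add]
      refine add_le_add (ih g) ?_
      have h1 := Real.one_sub_inv_le_log_of_pos (x := 1 + α) (by positivity)
      have h2 : 1 - (1 + α)⁻¹ = α / (1 + α) := by field_simp; ring
      rw [h2, div_le_iff₀ (by positivity)] at h1
      have h3 : 0 ≤ Real.log (1 + α) := Real.log_nonneg (by linarith)
      calc α ≤ Real.log (1 + α) * (1 + α) := h1
        _ ≤ Real.log (1 + α) * (1 + 1 / P.lam) := by gcongr
        _ = _ := mul_comm _ _
    · simpa using ih g

lemma sqrt_beta (hS : 0 ≤ P.S) (h : History d K t) (i : Fin K) :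
    √(beta P h i) =
      √(d * Real.log ((1 + h.numPulls i / P.lam) / (1 / (P.T : ℝ) ^ 2))) + √P.lam * P.S :=
  Real.sqrt_sq (by positivity)

/-- The factor in `log ((1 + n / λ) T²) ≤ c log T`. -/
noncomputable def logFactor (lam : ℝ) : ℝ := 3 + Real.log (1 + 1 / lam) / Real.log 2

/-- The factor in `√β ≤ c √(d log T)`. -/
noncomputable def radiusFactor (lam S : ℝ) : ℝ := √(logFactor lam) + √lam * S / √(Real.log 2)

/-- The factor in the bound `c d log T √n` for the sum of the widths of the confidence intervals
over `n` pulls. -/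
noncomputable def widthFactor (lam S : ℝ) : ℝ :=
  radiusFactor lam S * √((1 + 1 / lam) * logFactor lam)

lemma logFactor_pos {lam : ℝ} (hlam : 0 < lam) : 0 < logFactor lam := by
  have h1 : 0 ≤ Real.log (1 + 1 / lam) := Real.log_nonneg (by simp [hlam.le])
  have h2 := Real.log_pos (one_lt_two)
  unfold logFactor; positivity

lemma radiusFactor_nonneg {lam S : ℝ} (hS : 0 ≤ S) : 0 ≤ radiusFactor lam S := by
  unfold radiusFactor; positivity

lemma widthFactor_nonneg {lam S : ℝ} (hS : 0 ≤ S) : 0 ≤ widthFactor lam S :=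
  mul_nonneg (radiusFactor_nonneg hS) (Real.sqrt_nonneg _)

/-- Of the `3` in `logFactor`, two come from `T²` and one from `1 + n/λ ≤ T(1 + 1/λ)`; the constant
`log(1 + 1/λ)` is absorbed using `log T ≥ log 2`. -/
lemma log_one_add_mul_sq_le {lam : ℝ} (hlam : 0 < lam) (hT : 2 ≤ T) {n : ℕ} (hn : n ≤ T) :
    Real.log ((1 + n / lam) / (1 / (T : ℝ) ^ 2)) ≤ logFactor lam * Real.log T := by
  have hT2 : (2 : ℝ) ≤ T := by exact_mod_cast hT
  have hl2 := Real.log_pos one_lt_two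
  have hlT : Real.log 2 ≤ Real.log T := Real.log_le_log (by norm_num) hT2
  have hn' : (n : ℝ) ≤ T := by exact_mod_cast hn
  have h1 : Real.log (1 + n / lam) ≤ Real.log (T * (1 + 1 / lam)) := by
    refine Real.log_le_log (by positivity) ?_
    have : (n : ℝ) / lam ≤ T / lam := by gcongr
    rw [mul_add, mul_one_div]
    linarith
  rw [Real.log_mul (by positivity) (by positivity)] at h1
  have h2 : Real.log (1 + 1 / lam) ≤ Real.log (1 + 1 / lam) / Real.log 2 * Real.log T := by
    rw [div_mul_eq_mul_div, le_div_iff₀ hl2]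
    exact mul_le_mul_of_nonneg_left hlT (Real.log_nonneg (by simp [hlam.le]))
  rw [Real.log_div (by positivity) (by positivity), Real.log_div one_ne_zero (by positivity),
    Real.log_one, Real.log_pow, logFactor]
  push_cast
  linarith

lemma sqrt_beta_le (hlam : 0 < P.lam) (hS : 0 ≤ P.S) (hT : 2 ≤ P.T) (hd : 1 ≤ d)
    (h : History d K t) (ht : t ≤ P.T) (i : Fin K) :
    √(beta P h i) ≤ radiusFactor P.lam P.S * √(d * Real.log P.T) := by
  have hT2 : (2 : ℝ) ≤ P.T := by exact_mod_cast hT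
  have hl2 := Real.log_pos one_lt_two
  have hlT : Real.log 2 ≤ Real.log P.T := Real.log_le_log (by norm_num) hT2
  have hd' : (1 : ℝ) ≤ d := by exact_mod_cast hd
  rw [sqrt_beta hS, radiusFactor, add_mul]
  refine add_le_add ?_ ?_
  · rw [← Real.sqrt_mul (logFactor_pos hlam).le]
    refine Real.sqrt_le_sqrt ?_
    have := log_one_add_mul_sq_le hlam hT ((numPulls_le h i).trans ht)
    calc _ ≤ d * (logFactor P.lam * Real.log P.T) := by gcongr
      _ = _ := by ring
  · rw [div_mul_eq_mul_div, le_div_iff₀ (Real.sqrt_pos.2 hl2)]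
    refine mul_le_mul_of_nonneg_left (Real.sqrt_le_sqrt ?_) (by positivity)
    nlinarith

/-- Cauchy–Schwarz over the pulls, with the radius bounded uniformly. The bound is deterministic and
needs no truthfulness, so it also applies to a manipulating arm. -/
lemma sum_width_le (hlam : 0 < P.lam) (hS : 0 ≤ P.S) (hT : 2 ≤ P.T) (hd : 1 ≤ d)
    (h : History d K t) (ht : t ≤ P.T) (i : Fin K) :
    (∑ ℓ : Fin t, if h.arm ℓ = some i then width P h i ℓ else 0) ≤
      widthFactor P.lam P.S * (d * Real.log P.T) * √(h.numPulls i) := by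
  have hlT : 0 ≤ Real.log P.T := Real.log_natCast_nonneg _
  have hA := logFactor_pos hlam
  have hR := radiusFactor_nonneg (lam := P.lam) hS
  set m : Fin t → ℝ := fun ℓ => matNorm (gram P (h.before ℓ ℓ.2.le) i)⁻¹ (h.report ℓ i) with hm
  set I := Finset.univ.filter fun ℓ : Fin t => h.arm ℓ = some i with hI
  have hpot : ∑ ℓ ∈ I, m ℓ ^ 2 ≤ (1 + 1 / P.lam) * logFactor P.lam * (d * Real.log P.T) := by
    have h1 := sum_sq_matNorm_le_log_det hlam h i
    rw [← Finset.sum_filter] at h1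
    refine h1.trans ?_
    rw [mul_assoc]
    refine mul_le_mul_of_nonneg_left ((log_det_gram_le hlam h i).trans ?_) (by positivity)
    have h2 := log_one_add_mul_sq_le hlam hT ((numPulls_le h i).trans ht)
    have h3 : Real.log (1 + h.numPulls i / P.lam) ≤
        Real.log ((1 + h.numPulls i / P.lam) / (1 / (P.T : ℝ) ^ 2)) := by
      rw [Real.log_div (by positivity) (by positivity), Real.log_div one_ne_zero (by positivity),
        Real.log_one, Real.log_pow]
      have : 0 ≤ ((2 : ℕ) : ℝ) * Real.log P.T := by positivity
      linarith
    calc _ ≤ (d : ℝ) * (logFactor P.lam * Real.log P.T) := by gcongr; exact h3.trans h2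
      _ = _ := by ring
  have hsum : ∑ ℓ ∈ I, m ℓ ≤
      √(h.numPulls i) * √((1 + 1 / P.lam) * logFactor P.lam * (d * Real.log P.T)) := by
    rw [← Real.sqrt_mul (by positivity)]
    refine Real.le_sqrt_of_sq_le ?_
    refine (sq_sum_le_card_mul_sum_sq (s := I) (f := m)).trans ?_
    exact mul_le_mul_of_nonneg_left hpot (by positivity)
  rw [← Finset.sum_filter]
  calc ∑ ℓ ∈ I, width P h i ℓ
      ≤ ∑ ℓ ∈ I, radiusFactor P.lam P.S * √(d * Real.log P.T) * m ℓ := by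
        refine Finset.sum_le_sum fun ℓ _ => ?_
        exact mul_le_mul_of_nonneg_right
          (sqrt_beta_le hlam hS hT hd _ (ℓ.2.le.trans ht) i) (matNorm_nonneg _ _)
    _ ≤ radiusFactor P.lam P.S * √(d * Real.log P.T) *
        (√(h.numPulls i) * √((1 + 1 / P.lam) * logFactor P.lam * (d * Real.log P.T))) := by
        rw [← Finset.mul_sum]
        exact mul_le_mul_of_nonneg_left hsum (by positivity)
    _ = _ := by
        rw [Real.sqrt_mul (by positivity : 0 ≤ (1 + 1 / P.lam) * logFactor P.lam), widthFactor]
        have := Real.mul_self_sqrt (by positivity : 0 ≤ (d : ℝ) * Real.log P.T)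
        linear_combination radiusFactor P.lam P.S * √((1 + 1 / P.lam) * logFactor P.lam) *
          √(h.numPulls i) * this

end Elliptical

/-! ### Validity of confidence intervals and the grim trigger. -/

section Confidence

/-- Arm `i` reported its true contexts. -/
def ReportsTruthfully (E : Env d K) (h : History d K t) (i : Fin K) : Prop :=
  ∀ ℓ, h.report ℓ i = E.ctx ℓ i

/-- With truthful reports the rewards are linear in the reported contexts, so `θ̂ - θ* = V⁻¹(∑ η_ℓ
x_ℓ - λθ*)`. The noise and the ridge bias account for the two summands of `√β`. -/
lemma matNorm_thetaHat_sub_le (hlam : 0 < P.lam) (hS : ‖E.θ‖ ≤ P.S) {h : History d K t} {i : Fin K}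
    (htr : ReportsTruthfully E h i)
    (hcov : noiseQuad P E h i ≤
      d * Real.log ((1 + h.numPulls i / P.lam) / (1 / (P.T : ℝ) ^ 2))) :
    matNorm (gram P h i) (thetaHat P h i - E.θ) ≤ √(beta P h i) := by
  have hV := gram_posDef hlam h i
  have hVi := hV.inv
  have hsplit : (∑ ℓ : Fin t, if h.arm ℓ = some i then h.reward ℓ • (h.report ℓ i).ofLp else 0) =
      noiseVec E h i + (Matrix.mulVec (gram P h i) E.θ.ofLp - P.lam • E.θ.ofLp) := by
    rw [gram, Matrix.add_mulVec, Matrix.smul_mulVec, Matrix.one_mulVec, add_sub_cancel_left,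
      Matrix.sum_mulVec, noiseVec, ← Finset.sum_add_distrib]
    refine Finset.sum_congr rfl fun ℓ _ => ?_
    split_ifs
    · have : E.mean ℓ i = (h.report ℓ i).ofLp ⬝ᵥ E.θ.ofLp := by
        rw [Env.mean, EuclideanSpace.inner_eq_star_dotProduct, htr ℓ]; simp
      rw [Matrix.vecMulVec_mulVec, this]
      ext k; simp; ring
    · simp
  have hdiff : thetaHat P h i - E.θ = WithLp.toLp 2 (Matrix.mulVec (gram P h i)⁻¹
      (WithLp.toLp 2 (noiseVec E h i) + (-P.lam) • E.θ : EuclideanSpace ℝ (Fin d)).ofLp) := by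
    rw [thetaHat, hsplit]
    apply (WithLp.ofLp_injective 2)
    simp only [WithLp.ofLp_sub, WithLp.ofLp_add, WithLp.ofLp_smul, Matrix.mulVec_add,
      Matrix.mulVec_sub, Matrix.mulVec_smul]
    rw [inv_mulVec_mulVec hV]
    ext k; simp; ring
  have h1 : matNorm (gram P h i)⁻¹ (WithLp.toLp 2 (noiseVec E h i)) = √(noiseQuad P E h i) := rfl
  have h2 := matNorm_inv_le hlam hV (gram_sub_posSemidef P h i) E.θ
  rw [hdiff, matNorm_inv_mulVec hV, sqrt_beta ((norm_nonneg _).trans hS)]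
  refine (matNorm_add_le hVi.posSemidef _ _).trans (add_le_add ?_ ?_)
  · rw [h1]; exact Real.sqrt_le_sqrt hcov
  · rw [matNorm_smul hVi.posSemidef, abs_neg, abs_of_pos hlam]
    have hs : 0 < √P.lam := Real.sqrt_pos.2 hlam
    have hss : √P.lam * √P.lam = P.lam := Real.mul_self_sqrt hlam.le
    calc P.lam * matNorm (gram P h i)⁻¹ E.θ ≤ P.lam * (P.S / √P.lam) := by
          refine mul_le_mul_of_nonneg_left (h2.trans ?_) hlam.le
          gcongr
      _ = √P.lam * P.S := by
          nth_rewrite 1 [← hss]; field_simp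

lemma abs_inner_sub_le (hlam : 0 < P.lam) {h : History d K t} {i : Fin K}
    {θ : EuclideanSpace ℝ (Fin d)} (hθ : matNorm (gram P h i) (thetaHat P h i - θ) ≤ √(beta P h i))
    (x : EuclideanSpace ℝ (Fin d)) :
    |inner ℝ (thetaHat P h i) x - inner ℝ θ x| ≤ √(beta P h i) * matNorm (gram P h i)⁻¹ x := by
  rw [← inner_sub_left]
  exact (abs_inner_le_matNorm (gram_posDef hlam h i) _ _).trans
    (mul_le_mul_of_nonneg_right hθ (matNorm_nonneg _ _))

lemma inner_le_ucb_of_mem_confSet (hlam : 0 < P.lam) {h : History d K t} {i : Fin K}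
    {θ : EuclideanSpace ℝ (Fin d)} (hθ : θ ∈ confSet P h i) (x : EuclideanSpace ℝ (Fin d)) :
    inner ℝ θ x ≤ ucb P h i x := by
  have h1 := (abs_le.1 (abs_inner_sub_le hlam (Real.le_sqrt_of_sq_le hθ) x)).1
  rw [ucb]; linarith

/-- Arm `i` is truthful, its confidence sets are valid and its noise is not too negative. -/
structure Reliable (P : Params) (E : Env d K) (h : History d K T) (i : Fin K) : Prop where
  truthful : ReportsTruthfully E h i
  covered : Covered P E h i
  concentrated : Concentrated P E (-1) h i

lemma lcb_eq (h : History d K t) (i : Fin K) (ℓ : Fin t) :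
    lcb P (h.before ℓ ℓ.2.le) i (h.report ℓ i) =
      ucb P (h.before ℓ ℓ.2.le) i (h.report ℓ i) - 2 * width P h i ℓ := by
  rw [lcb, ucb, width]; ring

lemma Reliable.before {h : History d K T} {i : Fin K} (hr : Reliable P E h i) (s : ℕ) (hs : s ≤ T) :
    Reliable P E (h.before s hs) i where
  truthful ℓ := hr.truthful (Fin.castLE hs ℓ)
  covered r hr' := hr.covered r (hr'.trans hs)
  concentrated r hr' := hr.concentrated r (hr'.trans hs)

lemma Reliable.mean_mem (hlam : 0 < P.lam) (hS : ‖E.θ‖ ≤ P.S) {h : History d K T} {i : Fin K}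
    (hr : Reliable P E h i) (ℓ : Fin T) :
    E.mean ℓ i ≤ ucb P (h.before ℓ ℓ.2.le) i (h.report ℓ i) ∧
      lcb P (h.before ℓ ℓ.2.le) i (h.report ℓ i) ≤ E.mean ℓ i := by
  have hb := hr.before ℓ ℓ.2.le
  have h1 := matNorm_thetaHat_sub_le hlam hS hb.truthful (hr.covered ℓ ℓ.2.le)
  have h2 := abs_le.1 (abs_inner_sub_le hlam h1 (h.report ℓ i))
  have h3 : E.mean ℓ i = inner ℝ E.θ (h.report ℓ i) := by rw [Env.mean, hr.truthful ℓ]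
  rw [h3, ucb, lcb]
  exact ⟨by linarith [h2.1], by linarith [h2.2]⟩

lemma sum_reward_eq (E : Env d K) (h : History d K t) (i : Fin K) :
    (∑ ℓ : Fin t, if h.arm ℓ = some i then h.reward ℓ else 0) =
      (∑ ℓ : Fin t, if h.arm ℓ = some i then E.mean ℓ i else 0) + noiseSum E h i := by
  rw [noiseSum, ← Finset.sum_add_distrib]
  refine Finset.sum_congr rfl fun ℓ _ => ?_
  split_ifs <;> ring

/-- Each LCB is at most the true mean, and the trigger's slack `2√(n log T)` covers the negative
noise. -/
lemma Reliable.not_triggered (hlam : 0 < P.lam) (hS : ‖E.θ‖ ≤ P.S) {h : History d K t} {i : Fin K}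
    (hr : Reliable P E h i) : ¬ triggered P h i := by
  rw [triggered, not_lt, sum_reward_eq E]
  have h1 := hr.concentrated t le_rfl
  rw [before_self] at h1
  have h2 : (∑ ℓ : Fin t, if h.arm ℓ = some i then
        lcb P (h.before ℓ ℓ.2.le) i (h.report ℓ i) else 0) ≤
      ∑ ℓ : Fin t, if h.arm ℓ = some i then E.mean ℓ i else 0 := by
    refine Finset.sum_le_sum fun ℓ _ => ?_
    split_ifs
    · exact (hr.mean_mem hlam hS ℓ).2
    · exact le_rfl
  linarith

lemma Reliable.mem_active (hlam : 0 < P.lam) (hS : ‖E.θ‖ ≤ P.S) {h : History d K t} {i : Fin K}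
    (hr : Reliable P E h i) : i ∈ active P h := by
  simp only [active, Finset.mem_filter, Finset.mem_univ, true_and]
  exact fun s _ => (hr.before (s + 1) s.2).not_triggered hlam hS

/-- Activity tests the trigger only after pulls of `i`; in the rounds between, neither side of the
condition changes, so it also fails at the current time. -/
lemma not_triggered_of_mem_active {h : History d K t} {i : Fin K} (ha : i ∈ active P h) :
    ¬ triggered P h i := by
  induction t with
  | zero => simp [triggered, History.numPulls]
  | succ t ih =>
    obtain ⟨g, p, rfl⟩ : ∃ g : History d K t, ∃ p, h = g.extend p := ⟨_, _, eq_extend h⟩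
    simp only [active, Finset.mem_filter, Finset.mem_univ, true_and] at ha
    by_cases hp : p.2.1 = some i
    · exact ha (Fin.last t) (by simpa using hp)
    · have hb : ∀ ℓ : Fin t, (g.extend p).before (ℓ.castSucc : Fin (t + 1)) ℓ.castSucc.2.le =
          g.before ℓ ℓ.2.le := fun ℓ => extend_before g p ℓ.2.le
      have hg : i ∈ active P g := by
        simp only [active, Finset.mem_filter, Finset.mem_univ, true_and]
        intro s hs
        have := ha s.castSucc (by simpa using hs)
        have hb' : (g.extend p).before ((s.castSucc : Fin (t + 1)) + 1) s.castSucc.2 =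
          g.before (s + 1) s.2 := extend_before g p s.2
        rwa [hb'] at this
      have := ih hg
      rw [triggered, Fin.sum_univ_castSucc, Fin.sum_univ_castSucc, numPulls_extend]
      simp only [arm_extend_castSucc, reward_extend_castSucc, report_extend_castSucc,
        arm_extend_last, hp, if_false, add_zero]
      simp only [hb]
      exact this

end Confidence

/-! ### Deterministic bounds along a good history. -/

section Paths

/-- The arms were selected according to the mechanism. -/
def FollowsMechanism (P : Params) (h : History d K T) : Prop :=
  ∀ s : Fin T, (∀ i, h.arm s = some i → i ∈ argmaxSet P (h.before s s.2.le) (h s).1) ∧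
    (h.arm s = none → argmaxSet P (h.before s s.2.le) (h s).1 = ∅)

lemma argmaxSet_nonempty {h : History d K t} {x : Fin K → Ctx d} (ha : (active P h).Nonempty) :
    (argmaxSet P h x).Nonempty := by
  obtain ⟨i, hi, hmax⟩ := (active P h).exists_max_image (fun i => ucb P h i (x i)) ha
  exact ⟨i, by simp only [argmaxSet, Finset.mem_filter]; exact ⟨hi, hmax⟩⟩

lemma FollowsMechanism.ucb_le {h : History d K T} (hm : FollowsMechanism P h) {s : Fin T}
    {i j : Fin K} (hi : h.arm s = some i) (hj : j ∈ active P (h.before s s.2.le)) :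
    ucb P (h.before s s.2.le) j (h.report s j) ≤ ucb P (h.before s s.2.le) i (h.report s i) := by
  have := (hm s).1 i hi
  simp only [argmaxSet, Finset.mem_filter] at this
  exact this.2 j hj

lemma FollowsMechanism.mem_active {h : History d K T} (hm : FollowsMechanism P h) {s : Fin T}
    {i : Fin K} (hi : h.arm s = some i) : i ∈ active P (h.before s s.2.le) := by
  have := (hm s).1 i hi
  simp only [argmaxSet, Finset.mem_filter] at this
  exact this.1

/-- A single reliable arm suffices: it stays active, so the set of maximisers is never empty. -/
lemma FollowsMechanism.exists_arm (hlam : 0 < P.lam) (hS : ‖E.θ‖ ≤ P.S) {h : History d K T}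
    (hm : FollowsMechanism P h) {j : Fin K} (hr : Reliable P E h j) (s : Fin T) :
    ∃ i, h.arm s = some i := by
  by_contra hne
  have h0 : h.arm s = none := Option.eq_none_iff_forall_ne_some.2 (fun i hi => hne ⟨i, hi⟩)
  have h1 := argmaxSet_nonempty (x := (h s).1)
    ⟨j, (hr.before s s.2.le).mem_active hlam hS⟩
  rw [(hm s).2 h0] at h1
  exact Finset.not_nonempty_empty h1

/-- The regret along a history. -/
noncomputable def pathRegret (E : Env d K) (h : History d K T) : ℝ :=
  ∑ t : Fin T, ((⨆ i, E.mean t i) - (h.arm t).elim 0 (E.mean t))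

lemma sum_numPulls_le (h : History d K t) : ∑ i, h.numPulls i ≤ t := by
  simp only [History.numPulls, Finset.card_filter]
  rw [Finset.sum_comm]
  calc _ ≤ ∑ _ℓ : Fin t, 1 := by
        refine Finset.sum_le_sum fun ℓ _ => ?_
        cases hl : h.arm ℓ <;> simp
    _ = t := by simp

lemma sum_sqrt_numPulls_le (h : History d K t) : ∑ i, √(h.numPulls i) ≤ √(K * t) := by
  refine Real.le_sqrt_of_sq_le ?_
  refine (sq_sum_le_card_mul_sum_sq (s := Finset.univ) (f := fun i => √(h.numPulls i : ℝ))).trans ?_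
  simp only [Finset.card_univ, Fintype.card_fin]
  refine mul_le_mul_of_nonneg_left ?_ (by positivity)
  simp only [Real.sq_sqrt (Nat.cast_nonneg _)]
  exact_mod_cast sum_numPulls_le h

/-- Optimism: `mean j ≤ UCB j ≤ UCB i = LCB i + 2·width ≤ mean i + 2·width`. -/
lemma iSup_sub_mean_le [Nonempty (Fin K)] (hlam : 0 < P.lam) (hS : ‖E.θ‖ ≤ P.S) {h : History d K T}
    (hm : FollowsMechanism P h) (hr : ∀ j, Reliable P E h j) {s : Fin T} {i : Fin K}
    (hi : h.arm s = some i) : (⨆ j, E.mean s j) - E.mean s i ≤ 2 * width P h i s := by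
  rw [sub_le_iff_le_add']
  refine ciSup_le fun j => ?_
  have h1 := ((hr j).mean_mem hlam hS s).1
  have h2 := hm.ucb_le hi (((hr j).before s s.2.le).mem_active hlam hS)
  have h3 := ((hr i).mean_mem hlam hS s).2
  rw [lcb_eq] at h3
  linarith

lemma pathRegret_le [Nonempty (Fin K)] (hlam : 0 < P.lam) (hS : ‖E.θ‖ ≤ P.S) (hT : 2 ≤ P.T)
    (hd : 1 ≤ d) {h : History d K P.T} (hm : FollowsMechanism P h) (hr : ∀ j, Reliable P E h j) :
    pathRegret E h ≤ 2 * widthFactor P.lam P.S * (d * Real.log P.T * √(K * P.T)) := by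
  have hS0 : 0 ≤ P.S := (norm_nonneg _).trans hS
  have hlT : 0 ≤ Real.log P.T := Real.log_natCast_nonneg _
  have hW := widthFactor_nonneg (lam := P.lam) hS0
  calc pathRegret E h
      ≤ ∑ s : Fin P.T, ∑ i, if h.arm s = some i then 2 * width P h i s else 0 := by
        refine Finset.sum_le_sum fun s _ => ?_
        obtain ⟨i, hi⟩ := hm.exists_arm hlam hS (hr (Classical.arbitrary _)) s
        simp only [hi, Option.elim_some, Option.some.injEq, Finset.sum_ite_eq, Finset.mem_univ,
          if_true]
        exact iSup_sub_mean_le hlam hS hm hr hi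
    _ = ∑ i, 2 * ∑ s : Fin P.T, if h.arm s = some i then width P h i s else 0 := by
        rw [Finset.sum_comm]
        simp only [Finset.mul_sum, mul_ite, mul_zero]
    _ ≤ ∑ i, 2 * (widthFactor P.lam P.S * (d * Real.log P.T) * √(h.numPulls i)) := by
        gcongr with i
        exact sum_width_le hlam hS0 hT hd h le_rfl i
    _ = 2 * widthFactor P.lam P.S * (d * Real.log P.T) * ∑ i, √(h.numPulls i) := by
        rw [Finset.mul_sum]
        exact Finset.sum_congr rfl fun i _ => by ring
    _ ≤ 2 * widthFactor P.lam P.S * (d * Real.log P.T) * √(K * P.T) := by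
        gcongr
        exact sum_sqrt_numPulls_le h
    _ = _ := by ring

open Classical in
/-- The number of rounds in which arm `i` is better than all others by `Δ`. -/
noncomputable def numOptimal (E : Env d K) (Δ : ℝ) (T : ℕ) (i : Fin K) : ℕ :=
  (Finset.univ.filter fun s : Fin T => ∀ j, j ≠ i → E.mean s j + Δ ≤ E.mean s i).card

/-- Checked round by round. That some arm is always played matters: a round without a pull has
reward zero, and its regret would be negative if all means were negative. -/
lemma numOptimal_sub_numPulls_le [Nonempty (Fin K)] {Δ : ℝ} (hΔ : 0 < Δ) {h : History d K T}
    (harm : ∀ s, ∃ i, h.arm s = some i) (i : Fin K) :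
    (numOptimal E Δ T i - h.numPulls i : ℝ) * Δ ≤ pathRegret E h := by
  classical
  simp only [numOptimal, History.numPulls, Finset.card_filter, Nat.cast_sum]
  rw [← Finset.sum_sub_distrib, Finset.sum_mul]
  refine Finset.sum_le_sum fun s _ => ?_
  obtain ⟨k, hk⟩ := harm s
  have hle : ∀ j, E.mean s j ≤ ⨆ j, E.mean s j := le_ciSup (Set.finite_range _).bddAbove
  simp only [hk, Option.elim_some, Option.some.injEq]
  by_cases hki : k = i
  · subst hki
    have : (0 : ℝ) ≤ (⨆ j, E.mean s j) - E.mean s k := sub_nonneg.2 (hle k)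
    refine le_trans ?_ this
    rw [if_pos rfl]
    split_ifs <;> simp [hΔ.le]
  · by_cases hopt : ∀ j, j ≠ i → E.mean s j + Δ ≤ E.mean s i
    · have h1 := hopt k hki
      have h2 := hle i
      simp only [if_pos hopt, if_neg hki]
      push_cast
      linarith
    · simp only [if_neg hopt, if_neg hki]
      have := hle k
      push_cast
      linarith

open Classical in
/-- The number of pulls of arm `i` in rounds in which it is not optimal. -/
noncomputable def numWrong (E : Env d K) (Δ : ℝ) (h : History d K t) (i : Fin K) : ℕ :=
  (Finset.univ.filter fun s : Fin t =>
    h.arm s = some i ∧ ¬ ∀ j, j ≠ i → E.mean s j + Δ ≤ E.mean s i).card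

lemma numPulls_le_numOptimal_add (E : Env d K) (Δ : ℝ) (h : History d K t) (i : Fin K) :
    h.numPulls i ≤ numOptimal E Δ t i + numWrong E Δ h i := by
  classical
  refine (Finset.card_le_card fun s hs => ?_).trans (Finset.card_union_le _ _)
  simp only [Finset.mem_filter, Finset.mem_univ, true_and, Finset.mem_union] at hs ⊢
  tauto

/-- A deviating arm that does not under-report. -/
structure Deviating (P : Params) (E : Env d K) (h : History d K T) (i : Fin K) : Prop where
  noUnderReport : NoUnderReport P E h i
  concentrated : Concentrated P E 1 h i
  others : ∀ j, j ≠ i → Reliable P E h j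

lemma Deviating.mean_le_ucb (hlam : 0 < P.lam) {h : History d K T} {i : Fin K}
    (hd : Deviating P E h i) (s : Fin T) :
    E.mean s i ≤ ucb P (h.before s s.2.le) i (h.report s i) := by
  obtain ⟨θ, hθ, hle⟩ := hd.noUnderReport s
  exact hle.trans (inner_le_ucb_of_mem_confSet hlam hθ _)

/-- The optimal arm of that round is truthful and still active, so the report of `i` had to beat a
UCB that is at least the optimal mean. -/
lemma Deviating.mean_add_le_ucb (hlam : 0 < P.lam) (hS : ‖E.θ‖ ≤ P.S) {Δ : ℝ}
    (hgap : E.HasGap Δ T) {h : History d K T} (hm : FollowsMechanism P h) {i : Fin K}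
    (hd : Deviating P E h i) {s : Fin T} (hi : h.arm s = some i)
    (hw : ¬ ∀ j, j ≠ i → E.mean s j + Δ ≤ E.mean s i) :
    E.mean s i + Δ ≤ ucb P (h.before s s.2.le) i (h.report s i) := by
  obtain ⟨k, hk⟩ := hgap s s.2
  have hki : k ≠ i := fun hki => hw (hki ▸ hk)
  have hr := hd.others k hki
  exact (hk i hki.symm).trans ((hr.mean_mem hlam hS s).1.trans
    (hm.ucb_le hi ((hr.before s s.2.le).mem_active hlam hS)))

/-- At a pull arm `i` is still active, so the sum of its past LCBs is at most its rewards plus `2√(n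
log T)`, hence at most its means plus `4√(n log T)`. The excess `Δ` of the UCB on wrong pulls must
fit into this slack and twice the widths. -/
lemma Deviating.numWrong_mul_le_of_pull (hlam : 0 < P.lam) (hS : ‖E.θ‖ ≤ P.S) (hT : 2 ≤ P.T)
    (hd : 1 ≤ d) {Δ : ℝ} (hgap : E.HasGap Δ P.T) {h : History d K P.T}
    (hm : FollowsMechanism P h) {i : Fin K} (hdev : Deviating P E h i) {s : Fin P.T}
    (hi : h.arm s = some i) :
    numWrong E Δ (h.before s s.2.le) i * Δ ≤
      2 * (widthFactor P.lam P.S * (d * Real.log P.T) * √P.T) + 4 * √(P.T * Real.log P.T) := by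
  classical
  have hS0 : 0 ≤ P.S := (norm_nonneg _).trans hS
  have hlT : 0 ≤ Real.log P.T := Real.log_natCast_nonneg _
  have hW := widthFactor_nonneg (lam := P.lam) hS0
  set g := h.before s s.2.le with hg
  have hnt := not_triggered_of_mem_active (hm.mem_active hi)
  rw [triggered, not_lt, sum_reward_eq E, ← hg] at hnt
  have hconc := hdev.concentrated s s.2.le
  rw [one_mul, ← hg] at hconc
  have hn : (g.numPulls i : ℝ) ≤ P.T := by exact_mod_cast (numPulls_le g i).trans s.2.le
  have hsq : √(g.numPulls i * Real.log P.T) ≤ √(P.T * Real.log P.T) :=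
    Real.sqrt_le_sqrt (by gcongr)
  have hwid := sum_width_le hlam hS0 hT hd g s.2.le i
  have hwid' : widthFactor P.lam P.S * (d * Real.log P.T) * √(g.numPulls i) ≤
      widthFactor P.lam P.S * (d * Real.log P.T) * √P.T := by gcongr
  have hsum : numWrong E Δ g i * Δ +
      (∑ ℓ : Fin s, if g.arm ℓ = some i then E.mean ℓ i else 0) ≤
      (∑ ℓ : Fin s, if g.arm ℓ = some i then
        lcb P (g.before ℓ ℓ.2.le) i (g.report ℓ i) else 0) +
      2 * ∑ ℓ : Fin s, if g.arm ℓ = some i then width P g i ℓ else 0 := by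
    simp only [numWrong, Finset.card_filter, Nat.cast_sum]
    rw [Finset.sum_mul, Finset.mul_sum, ← Finset.sum_add_distrib, ← Finset.sum_add_distrib]
    refine Finset.sum_le_sum fun ℓ _ => ?_
    by_cases hℓ : g.arm ℓ = some i
    · rw [if_pos hℓ, if_pos hℓ, if_pos hℓ, lcb_eq, sub_add_cancel]
      by_cases hw : ∀ j, j ≠ i → E.mean ℓ j + Δ ≤ E.mean ℓ i
      · rw [if_neg (fun hc => hc.2 hw)]
        rw [Nat.cast_zero, zero_mul, zero_add]
        exact hdev.mean_le_ucb hlam (Fin.castLE s.2.le ℓ)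
      · rw [if_pos ⟨hℓ, hw⟩]
        have := hdev.mean_add_le_ucb hlam hS hgap hm (s := Fin.castLE s.2.le ℓ) hℓ hw
        rw [Nat.cast_one, one_mul, add_comm]
        exact this
    · simp [hℓ]
  linarith

lemma numWrong_extend_le (E : Env d K) (Δ : ℝ) (g : History d K t) (p : Round d K) (i : Fin K) :
    numWrong E Δ (g.extend p) i ≤ numWrong E Δ g i + if p.2.1 = some i then 1 else 0 := by
  classical
  rw [numWrong, numWrong, Finset.card_filter, Finset.card_filter, Fin.sum_univ_castSucc]
  simp only [arm_extend_castSucc, arm_extend_last, Fin.val_castSucc]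
  gcongr
  split_ifs <;> simp_all

lemma Deviating.numWrong_mul_le (hlam : 0 < P.lam) (hS : ‖E.θ‖ ≤ P.S) (hT : 2 ≤ P.T)
    (hd : 1 ≤ d) {Δ : ℝ} (hΔ : 0 < Δ) (hgap : E.HasGap Δ P.T) {h : History d K P.T}
    (hm : FollowsMechanism P h) {i : Fin K} (hdev : Deviating P E h i) :
    numWrong E Δ h i * Δ ≤ Δ +
      2 * (widthFactor P.lam P.S * (d * Real.log P.T) * √P.T) + 4 * √(P.T * Real.log P.T) := by
  have hlT : 0 ≤ Real.log P.T := Real.log_natCast_nonneg _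
  have hW := widthFactor_nonneg (lam := P.lam) ((norm_nonneg _).trans hS)
  have main : ∀ s, ∀ hs : s ≤ P.T, numWrong E Δ (h.before s hs) i * Δ ≤ Δ +
      2 * (widthFactor P.lam P.S * (d * Real.log P.T) * √P.T) + 4 * √(P.T * Real.log P.T) := by
    intro s
    induction s with
    | zero => intro hs; simp [numWrong]; positivity
    | succ s ih =>
      intro hs
      have hx : h.before (s + 1) hs = (h.before s (by omega)).extend (h ⟨s, hs⟩) :=
        eq_extend (h.before (s + 1) hs)
      have h1 := numWrong_extend_le E Δ (h.before s (by omega)) (h ⟨s, hs⟩) i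
      rw [← hx] at h1
      by_cases ha : (h ⟨s, hs⟩).2.1 = some i
      · rw [if_pos ha] at h1
        -- The bound holds just before a pull; this pull may itself be the one that eliminates the
        -- arm, whence the additional `Δ`.
        have h2 := hdev.numWrong_mul_le_of_pull hlam hS hT hd hgap hm (s := ⟨s, hs⟩) ha
        have h3 : (numWrong E Δ (h.before (s + 1) hs) i : ℝ) ≤
            numWrong E Δ (h.before s (by omega)) i + 1 := by exact_mod_cast h1
        have h4 := mul_le_mul_of_nonneg_right h3 hΔ.le
        simp only at h2
        linarith
      · rw [if_neg ha, add_zero] at h1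
        have h3 : (numWrong E Δ (h.before (s + 1) hs) i : ℝ) ≤
            numWrong E Δ (h.before s (by omega)) i := by exact_mod_cast h1
        exact (mul_le_mul_of_nonneg_right h3 hΔ.le).trans (ih (by omega))
  exact main P.T le_rfl

end Paths

variable {d K t T : ℕ} {P : Params} {tie : TieBreak K} {E : Env d K} {σ : Fin K → Strategy d K}

/-! ### Properties that hold almost surely. -/

section AlmostSure

lemma ae_selectMeasure (tie : TieBreak K) (t : ℕ) (s : Finset (Fin K)) :
    ∀ᵐ a ∂(selectMeasure tie t s), (∀ i, a = some i → i ∈ s) ∧ (a = none → s = ∅) := by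
  unfold selectMeasure
  split_ifs with hs
  · rw [ae_iff, PMF.toMeasure_apply_eq_zero_iff _ (by trivial), Set.disjoint_left]
    intro a ha hna
    simp only [PMF.support_map, Set.mem_image] at ha
    obtain ⟨i, hi, rfl⟩ := ha
    have := tie.mem t s hs i hi
    simp [this] at hna
  · rw [ae_dirac_eq]
    simpa using Finset.not_nonempty_iff_eq_empty.1 hs

lemma measurableSet_selected {α : Type*} [MeasurableSpace α] (P : Params)
    {H : α → History d K t} (hH : Measurable H) {X : α → Fin K → Ctx d} (hX : Measurable X)
    {A : α → Option (Fin K)} (hA : Measurable A) :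
    MeasurableSet {z | (∀ i, A z = some i → i ∈ argmaxSet P (H z) (X z)) ∧
      (A z = none → argmaxSet P (H z) (X z) = ∅)} := by
  have ha : ∀ a, MeasurableSet {z | A z = a} := fun a => hA (measurableSet_singleton a)
  have h1 : ∀ i, MeasurableSet {z | i ∈ argmaxSet P (H z) (X z)} := fun i =>
    (hH.prodMk hX) (measurableSet_setOfPred.2 (measurable_mem_argmaxSet P i))
  have h2 : MeasurableSet {z | argmaxSet P (H z) (X z) = ∅} :=
    (hH.prodMk hX) (measurableSet_argmaxSet_eq P ∅)
  have h3 : {z | (∀ i, A z = some i → i ∈ argmaxSet P (H z) (X z)) ∧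
      (A z = none → argmaxSet P (H z) (X z) = ∅)} =
      (⋂ i, {z | A z = some i}ᶜ ∪ {z | i ∈ argmaxSet P (H z) (X z)}) ∩
        ({z | A z = none}ᶜ ∪ {z | argmaxSet P (H z) (X z) = ∅}) := by
    ext z
    simp only [Set.mem_ofPred_eq, Set.mem_inter_iff, Set.mem_iInter, Set.mem_union,
      Set.mem_compl_iff, imp_iff_not_or]
  rw [h3]
  exact (MeasurableSet.iInter fun i => (ha _).compl.union (h1 i)).inter ((ha _).compl.union h2)

lemma ae_followsMechanism (P : Params) (tie : TieBreak K) (E : Env d K)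
    (σ : Fin K → Strategy d K) (T : ℕ) :
    ∀ᵐ h ∂(law P tie E σ T), FollowsMechanism P h := by
  refine ae_law_of_ae_step P tie E σ (fun t h p =>
    (∀ i, p.2.1 = some i → i ∈ argmaxSet P h p.1) ∧ (p.2.1 = none → argmaxSet P h p.1 = ∅)) T
    (fun t => ?_) (fun t _ h => ?_)
  · exact measurableSet_selected P measurable_fst (measurable_fst.comp measurable_snd)
      (measurable_fst.comp (measurable_snd.comp measurable_snd))
  · refine ae_stepKernel P tie E σ h ?_ (Filter.Eventually.of_forall fun x => ?_)
    · exact measurableSet_selected P measurable_const measurable_fst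
        (measurable_fst.comp measurable_snd)
    · filter_upwards [ae_selectMeasure tie t (argmaxSet P h x)] with a ha r
      exact ha

lemma ae_reportsTruthfully {j : Fin K} (hj : σ j = truthful) (T : ℕ) :
    ∀ᵐ h ∂(law P tie E σ T), ReportsTruthfully E h j := by
  have hm : Measurable fun p : Round d K => p.1 j := by fun_prop
  have := ae_law_of_ae_step P tie E σ (fun t _ p => p.1 j = E.ctx t j) T
    (fun t => (hm.comp measurable_snd) (measurableSet_singleton _)) (fun t _ h => ?_)
  · filter_upwards [this] with h hh s
    exact congrArg Subtype.val (hh s)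
  · refine ae_stepKernel P tie E σ h (hm (measurableSet_singleton _)) ?_
    have hmk : ∀ i, IsProbabilityMeasure ((σ i).law t (h, E.ctx t i)) := fun i =>
      ((σ i).markov t).isProbabilityMeasure _
    have h1 : ∀ᵐ y ∂((σ j).law t (h, E.ctx t j)), y = E.ctx t j := by
      rw [hj]
      change ∀ᵐ y ∂(Kernel.deterministic (fun p : History d K t × Ctx d => p.2) measurable_snd
        (h, E.ctx t j)), y = E.ctx t j
      rw [Kernel.deterministic_apply, ae_dirac_eq]
      rfl
    have h2 := (Measure.tendsto_eval_ae_ae (μ := fun i => (σ i).law t (h, E.ctx t i)) (i := j)) h1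
    change ∀ᵐ x ∂(Measure.pi fun i => (σ i).law t (h, E.ctx t i)), _
    filter_upwards [h2] with x hx
    exact Filter.Eventually.of_forall fun a r => hx

end AlmostSure

/-! ### Probabilities of the bad events and their cost. -/

section FailureProbability

variable {S : ℝ}

lemma law_not_reliable_le (hlam : 0 < P.lam) (hT : 2 ≤ P.T) (hd : 1 ≤ d) (hE : E.Regular S P.T)
    {j : Fin K} (hj : σ j = truthful) :
    law P tie E σ P.T {h | ¬ Reliable P E h j} ≤ ENNReal.ofReal (2 / P.T) := by
  have h1 : law P tie E σ P.T {h | ¬ ReportsTruthfully E h j} = 0 := ae_iff.1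
    (ae_reportsTruthfully hj P.T)
  have h2 := law_not_covered_le (tie := tie) (σ := σ) hlam hT hd hE j
  have h3 := law_not_concentrated_le (tie := tie) (σ := σ) hT hE (c := -1) (by norm_num) j
  have hsub : {h : History d K P.T | ¬ Reliable P E h j} ⊆
      {h | ¬ ReportsTruthfully E h j} ∪ ({h | ¬ Covered P E h j} ∪
        {h | ¬ Concentrated P E (-1) h j}) := by
    intro h hh
    by_contra hc
    simp only [Set.mem_union, Set.mem_ofPred_eq, not_or, not_not] at hc
    exact hh ⟨hc.1, hc.2.1, hc.2.2⟩
  refine (measure_mono hsub).trans ((measure_union_le _ _).trans ?_)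
  rw [h1, zero_add]
  refine (measure_union_le _ _).trans ((add_le_add h2 h3).trans (le_of_eq ?_))
  rw [← ENNReal.ofReal_add (by positivity) (by positivity)]
  congr 1
  ring

lemma law_exists_not_reliable_le (hlam : 0 < P.lam) (hT : 2 ≤ P.T) (hd : 1 ≤ d)
    (hE : E.Regular S P.T) {J : Finset (Fin K)} (hJ : ∀ j ∈ J, σ j = truthful) :
    law P tie E σ P.T {h | ¬ (FollowsMechanism P h ∧ ∀ j ∈ J, Reliable P E h j)} ≤
      ENNReal.ofReal (2 * K / P.T) := by
  have h1 : law P tie E σ P.T {h | ¬ FollowsMechanism P h} = 0 :=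
    ae_iff.1 (ae_followsMechanism P tie E σ P.T)
  have hsub : {h : History d K P.T | ¬ (FollowsMechanism P h ∧ ∀ j ∈ J, Reliable P E h j)} ⊆
      {h | ¬ FollowsMechanism P h} ∪ ⋃ j ∈ J, {h | ¬ Reliable P E h j} := by
    intro h hh
    by_contra hc
    simp only [Set.mem_union, Set.mem_ofPred_eq, not_or, not_not, Set.mem_iUnion, not_exists] at hc
    exact hh ⟨hc.1, hc.2⟩
  refine (measure_mono hsub).trans ((measure_union_le _ _).trans ?_)
  rw [h1, zero_add]
  refine (measure_biUnion_finset_le _ _).trans ?_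
  calc _ ≤ ∑ _j ∈ J, ENNReal.ofReal (2 / P.T) :=
        Finset.sum_le_sum fun j hj => law_not_reliable_le hlam hT hd hE (hJ j hj)
    _ = ENNReal.ofReal (J.card * (2 / P.T)) := by
        rw [Finset.sum_const, nsmul_eq_mul, ENNReal.ofReal_mul (by positivity),
          ENNReal.ofReal_natCast]
    _ ≤ ENNReal.ofReal (2 * K / P.T) := by
        refine ENNReal.ofReal_le_ofReal ?_
        have : (J.card : ℝ) ≤ K := by exact_mod_cast J.card_le_univ.trans_eq (Fintype.card_fin K)
        calc _ ≤ (K : ℝ) * (2 / P.T) := by gcongr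
          _ = _ := by ring

lemma law_not_deviating_le (hlam : 0 < P.lam) (hT : 2 ≤ P.T) (hd : 1 ≤ d) (hK : 1 ≤ K)
    (hE : E.Regular S P.T) {i : Fin K} (hσ : ∀ j ≠ i, σ j = truthful)
    (hadm : Admissible P tie E σ i) :
    law P tie E σ P.T {h | ¬ (FollowsMechanism P h ∧ Deviating P E h i)} ≤
      ENNReal.ofReal (4 * K / P.T) := by
  have h1 := law_exists_not_reliable_le (tie := tie) hlam hT hd hE (J := Finset.univ.erase i)
    (σ := σ) (fun j hj => hσ j (Finset.ne_of_mem_erase hj))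
  have h2 := law_not_concentrated_le (tie := tie) (σ := σ) hT hE (c := 1) (by norm_num) i
  have h3 : law P tie E σ P.T {h | ¬ NoUnderReport P E h i} ≤ ENNReal.ofReal (1 / P.T) := by
    refine hadm.trans_eq ?_
    rw [one_div, ENNReal.ofReal_inv_of_pos (by positivity), ENNReal.ofReal_natCast]
  have hsub : {h : History d K P.T | ¬ (FollowsMechanism P h ∧ Deviating P E h i)} ⊆
      {h | ¬ (FollowsMechanism P h ∧ ∀ j ∈ Finset.univ.erase i, Reliable P E h j)} ∪
        ({h | ¬ Concentrated P E 1 h i} ∪ {h | ¬ NoUnderReport P E h i}) := by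
    intro h hh
    by_contra hc
    simp only [Set.mem_union, Set.mem_ofPred_eq, not_or, not_not] at hc
    exact hh ⟨hc.1.1, hc.2.2, hc.2.1, fun j hj => hc.1.2 j (by simp [hj])⟩
  refine (measure_mono hsub).trans ((measure_union_le _ _).trans ?_)
  refine (add_le_add h1 ((measure_union_le _ _).trans (add_le_add h2 h3))).trans ?_
  rw [← ENNReal.ofReal_add (by positivity) (by positivity),
    ← ENNReal.ofReal_add (by positivity) (by positivity)]
  refine ENNReal.ofReal_le_ofReal ?_
  have hK' : (1 : ℝ) ≤ K := by exact_mod_cast hK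
  rw [← add_div, ← add_div]
  gcongr
  linarith

/-- A variable bounded by `M` everywhere and by `B` outside of an event of probability at most
`c K / T`, has expectation at most `B + M c √(K / T)`. -/
lemma integral_le_of_le_off {Ω : Type*} [MeasurableSpace Ω] {μ : Measure Ω}
    [IsProbabilityMeasure μ] {f : Ω → ℝ} (hf : Integrable f μ) {G : Ω → Prop} {B m c : ℝ} {k n : ℕ}
    (hB : 0 ≤ B) (hm : 0 ≤ m) (hc : 1 ≤ c) (hn : 0 < n) (hM : ∀ ω, f ω ≤ m * n)
    (hG : ∀ ω, G ω → f ω ≤ B) (hμ : μ {ω | ¬ G ω} ≤ ENNReal.ofReal (c * k / n)) :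
    ∫ ω, f ω ∂μ ≤ B + m * (c * √(k * n)) := by
  have hn' : (0 : ℝ) < n := by exact_mod_cast hn
  -- The bad event need not be measurable; a measurable hull has the same measure.
  set A := toMeasurable μ {ω | ¬ G ω} with hA
  have hAm : MeasurableSet A := measurableSet_toMeasurable _ _
  have hp1 : μ.real A ≤ 1 := measureReal_le_one
  have hp2 : μ.real A ≤ c * k / n := by
    rw [Measure.real, hA, measure_toMeasurable]
    exact ENNReal.toReal_le_of_le_ofReal (by positivity) hμ
  have hp0 : 0 ≤ μ.real A := measureReal_nonneg
  -- `n μ(A)` is at most `n` and at most `c k`, hence at most their geometric mean, and `√c ≤ c`.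
  have hpn : n * μ.real A ≤ c * √(k * n) := by
    have h1 : n * μ.real A ≤ n := by nlinarith
    have h2 : n * μ.real A ≤ c * k := by
      calc n * μ.real A ≤ n * (c * k / n) := by gcongr
        _ = c * k := by field_simp
    refine le_of_sq_le_sq ?_ (by positivity)
    rw [mul_pow, mul_pow, Real.sq_sqrt (by positivity), ← mul_pow, sq]
    calc (n * μ.real A) * (n * μ.real A) ≤ n * (c * k) := by gcongr
      _ = c * (k * n) := by ring
      _ ≤ c ^ 2 * (k * n) := by
          refine mul_le_mul_of_nonneg_right ?_ (by positivity)
          nlinarith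
  have hi : Integrable (fun ω => B + A.indicator (fun _ => m * n) ω) μ :=
    (integrable_const _).add ((integrable_const _).indicator hAm)
  have hle : ∀ ω, f ω ≤ B + A.indicator (fun _ => m * n) ω := by
    intro ω
    by_cases hω : ω ∈ A
    · rw [Set.indicator_of_mem hω]
      linarith [hM ω]
    · rw [Set.indicator_of_notMem hω, add_zero]
      refine hG ω (not_not.1 fun h => hω ?_)
      exact subset_toMeasurable μ _ h
  calc ∫ ω, f ω ∂μ ≤ ∫ ω, (B + A.indicator (fun _ => m * n) ω) ∂μ :=
        integral_mono hf hi hle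
    _ = B + m * (n * μ.real A) := by
        rw [integral_add (integrable_const _) ((integrable_const _).indicator hAm),
          integral_indicator hAm]
        simp
        ring
    _ ≤ _ := by gcongr

end FailureProbability

/-! ### Expected utilities and regret. -/

section Main

variable {S : ℝ}

lemma integrable_numPulls (i : Fin K) :
    Integrable (fun h => (h.numPulls i : ℝ)) (law P tie E σ P.T) := by
  refine Integrable.of_bound (measurable_numPulls i).aestronglyMeasurable (P.T : ℝ)
    (Filter.Eventually.of_forall fun h => ?_)
  rw [Real.norm_of_nonneg (by positivity)]
  exact_mod_cast numPulls_le h i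

lemma abs_mean_le (hS : ‖E.θ‖ ≤ S) (t : ℕ) (i : Fin K) : |E.mean t i| ≤ S :=
  (abs_real_inner_le_norm _ _).trans
    ((mul_le_of_le_one_right (norm_nonneg _) (norm_ctx_le _)).trans hS)

lemma abs_regret_round_le [Nonempty (Fin K)] (hS : ‖E.θ‖ ≤ S) (t : ℕ) (a : Option (Fin K)) :
    |(⨆ i, E.mean t i) - a.elim 0 (E.mean t)| ≤ 2 * S := by
  have hS0 := (norm_nonneg _).trans hS
  have h1 : (⨆ i, E.mean t i) ≤ S := ciSup_le fun i => (abs_le.1 (abs_mean_le hS t i)).2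
  have h2 : -S ≤ ⨆ i, E.mean t i :=
    (abs_le.1 (abs_mean_le hS t (Classical.arbitrary _))).1.trans
      (le_ciSup (Set.finite_range (E.mean t)).bddAbove _)
  have h3 : |a.elim 0 (E.mean t)| ≤ S := by
    cases a with
    | none => simpa using hS0
    | some i => exact abs_mean_le hS t i
  rw [abs_le] at h3 ⊢
  constructor <;> linarith [h3.1, h3.2]

lemma abs_pathRegret_le [Nonempty (Fin K)] (hS : ‖E.θ‖ ≤ S) (h : History d K T) :
    |pathRegret E h| ≤ 2 * S * T := by
  refine (Finset.abs_sum_le_sum_abs _ _).trans ?_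
  refine (Finset.sum_le_sum fun s _ => abs_regret_round_le hS _ _).trans_eq ?_
  simp [mul_comm]

lemma integrable_pathRegret [Nonempty (Fin K)] (hS : ‖E.θ‖ ≤ S) :
    Integrable (fun h => pathRegret E h) (law P tie E σ T) := by
  refine Integrable.of_bound (Measurable.aestronglyMeasurable ?_) (2 * S * T)
    (Filter.Eventually.of_forall fun h => abs_pathRegret_le hS h)
  refine Finset.measurable_sum _ fun s _ => measurable_const.sub ?_
  exact (Measurable.of_discrete (f := fun a : Option (Fin K) => a.elim 0 (E.mean s))).comp
    (measurable_arm s)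

lemma numOptimal_le (E : Env d K) (Δ : ℝ) (T : ℕ) (i : Fin K) : numOptimal E Δ T i ≤ T := by
  classical
  exact (Finset.card_filter_le _ _).trans_eq (by simp)

lemma regret_truthful_le (hlam : 0 < P.lam) (hT : 2 ≤ P.T) (hd : 1 ≤ d) (hK : 1 ≤ K)
    (hE : E.Regular P.S P.T) :
    regret P tie E (fun _ => truthful) ≤
      2 * widthFactor P.lam P.S * (d * Real.log P.T * √(K * P.T)) +
        2 * P.S * (2 * √(K * P.T)) := by
  have hne : Nonempty (Fin K) := ⟨⟨0, hK⟩⟩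
  have hS0 : 0 ≤ P.S := (norm_nonneg _).trans hE.norm_le
  have hW := widthFactor_nonneg (lam := P.lam) hS0
  have hlT : 0 ≤ Real.log P.T := Real.log_natCast_nonneg _
  refine integral_le_of_le_off (integrable_pathRegret hE.norm_le) (by positivity) (by positivity)
    (by norm_num) (by omega)
    (fun h => (le_abs_self _).trans (abs_pathRegret_le hE.norm_le h))
    (fun h hh => pathRegret_le hlam hE.norm_le hT hd hh.1 fun j => hh.2 j (Finset.mem_univ j))
    (law_exists_not_reliable_le hlam hT hd hE fun j _ => rfl)

/-- A lower bound on the truthful utility relative to the benchmark `numOptimal`, which does not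
depend on the strategies. Combined with the upper bound for a deviation, it makes the benchmark
cancel. -/
lemma numOptimal_sub_utility_le (hlam : 0 < P.lam) (hT : 2 ≤ P.T) (hd : 1 ≤ d) (hK : 1 ≤ K)
    (hE : E.Regular P.S P.T) {Δ : ℝ} (hΔ : 0 < Δ) (i : Fin K) :
    numOptimal E Δ P.T i - utility P tie E (fun _ => truthful) i ≤
      2 * widthFactor P.lam P.S * (d * Real.log P.T * √(K * P.T)) / Δ + 2 * √(K * P.T) := by
  have hne : Nonempty (Fin K) := ⟨⟨0, hK⟩⟩
  have hW := widthFactor_nonneg (lam := P.lam) ((norm_nonneg _).trans hE.norm_le)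
  have hlT : 0 ≤ Real.log P.T := Real.log_natCast_nonneg _
  have hint := integrable_numPulls (P := P) (tie := tie) (E := E) (σ := fun _ => truthful) i
  have h1 := integral_le_of_le_off (m := 1) (c := 2) (k := K) (n := P.T)
    (B := 2 * widthFactor P.lam P.S * (d * Real.log P.T * √(K * P.T)) / Δ)
    ((integrable_const (numOptimal E Δ P.T i : ℝ)).sub hint)
    (by positivity) zero_le_one (by norm_num) (by omega)
    (fun h => ?_) (fun h hh => ?_)
    (law_exists_not_reliable_le (J := Finset.univ) hlam hT hd hE fun j _ => rfl)
  · simp only [Pi.sub_apply] at h1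
    rw [integral_sub (integrable_const _) hint] at h1
    simpa [utility] using h1
  · have h2 : (numOptimal E Δ P.T i : ℝ) ≤ P.T := by exact_mod_cast numOptimal_le E Δ P.T i
    have h3 : (0 : ℝ) ≤ h.numPulls i := Nat.cast_nonneg _
    simp only [Pi.sub_apply]
    linarith
  · rw [le_div_iff₀ hΔ]
    have hr := fun j => hh.2 j (Finset.mem_univ j)
    exact (numOptimal_sub_numPulls_le hΔ
      (hh.1.exists_arm hlam hE.norm_le (hr i)) i).trans
      (pathRegret_le hlam hE.norm_le hT hd hh.1 hr)

lemma utility_deviation_sub_le (hlam : 0 < P.lam) (hT : 2 ≤ P.T) (hd : 1 ≤ d) (hK : 1 ≤ K)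
    (hE : E.Regular P.S P.T) {Δ : ℝ} (hΔ : 0 < Δ) (hgap : E.HasGap Δ P.T) {i : Fin K}
    (hσ : ∀ j ≠ i, σ j = truthful) (hadm : Admissible P tie E σ i) :
    utility P tie E σ i - numOptimal E Δ P.T i ≤
      (Δ + 2 * (widthFactor P.lam P.S * (d * Real.log P.T) * √P.T) +
        4 * √(P.T * Real.log P.T)) / Δ + 4 * √(K * P.T) := by
  have hW := widthFactor_nonneg (lam := P.lam) ((norm_nonneg _).trans hE.norm_le)
  have hlT : 0 ≤ Real.log P.T := Real.log_natCast_nonneg _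
  have hint := integrable_numPulls (P := P) (tie := tie) (E := E) (σ := σ) i
  have h1 := integral_le_of_le_off (m := 1) (c := 4) (k := K) (n := P.T)
    (B := (Δ + 2 * (widthFactor P.lam P.S * (d * Real.log P.T) * √P.T) +
        4 * √(P.T * Real.log P.T)) / Δ)
    (hint.sub (integrable_const (numOptimal E Δ P.T i : ℝ)))
    (by positivity) zero_le_one (by norm_num) (by omega)
    (fun h => ?_) (fun h hh => ?_)
    (law_not_deviating_le hlam hT hd hK hE hσ hadm)
  · simp only [Pi.sub_apply] at h1
    rw [integral_sub hint (integrable_const _)] at h1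
    simpa [utility] using h1
  · have h2 : (h.numPulls i : ℝ) ≤ P.T := by exact_mod_cast numPulls_le h i
    have h3 : (0 : ℝ) ≤ numOptimal E Δ P.T i := Nat.cast_nonneg _
    simp only [Pi.sub_apply]
    linarith
  · rw [le_div_iff₀ hΔ]
    refine le_trans (mul_le_mul_of_nonneg_right ?_ hΔ.le)
      (hh.2.numWrong_mul_le hlam hE.norm_le hT hd hΔ hgap hh.1)
    have : (h.numPulls i : ℝ) ≤ numOptimal E Δ P.T i + numWrong E Δ h i := by
      exact_mod_cast numPulls_le_numOptimal_add E Δ h i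
    simp only [Pi.sub_apply]
    linarith

end Main

end StrategicBandit

/-- For fixed `λ > 0`, `S` and `Δ > 0` there is a constant `C` such that, under the Optimistic Grim
Trigger Mechanism, truthfulness is a `C d log(T) √(KT)`-Nash equilibrium, and the strategic regret
under the truthful profile is at most `C d log(T) √(KT)`. -/
theorem mainTheorem2 (lam S Δ : ℝ) (hlam : 0 < lam) (hΔ : 0 < Δ) :
    ∃ C : ℝ, ∀ (d K T : ℕ), 1 ≤ d → 1 ≤ K → 2 ≤ T →
      ∀ (tie : StrategicBandit.TieBreak K) (E : StrategicBandit.Env d K), E.Regular S T →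
        (E.HasGap Δ T →
          StrategicBandit.IsApproxNE ⟨T, lam, S⟩ tie E
            (C * (d * Real.log T * √(K * T))) (fun _ => StrategicBandit.truthful)) ∧
        StrategicBandit.regret ⟨T, lam, S⟩ tie E (fun _ => StrategicBandit.truthful)
          ≤ C * (d * Real.log T * √(K * T)) := by
  set W := StrategicBandit.widthFactor lam S with hWdef
  have hl2 := Real.log_pos one_lt_two
  set c := 1 / Real.log 2 with hc
  have hc0 : 0 < c := by positivity
  -- Sum of the two requirements. The first two terms serve the equilibrium, with `7 = 1 + 4 + 2`
  -- for the last pull and the failure events of the deviating and truthful profiles; the bracket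
  -- serves the regret.
  refine ⟨(4 * W + 4 * c) / Δ + 7 * c + (2 * W + 4 * S * c), ?_⟩
  intro d K T hd hK hT tie E hE
  have hS0 : 0 ≤ S := (norm_nonneg _).trans hE.norm_le
  have hW : 0 ≤ W := StrategicBandit.widthFactor_nonneg hS0
  have hd' : (1 : ℝ) ≤ d := by exact_mod_cast hd
  have hK' : (1 : ℝ) ≤ K := by exact_mod_cast hK
  have hT' : (2 : ℝ) ≤ T := by exact_mod_cast hT
  have hlT : Real.log 2 ≤ Real.log T := Real.log_le_log (by norm_num) hT'
  have hlT0 : 0 < Real.log T := hl2.trans_le hlT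
  have hTK : √(T : ℝ) ≤ √(K * T) := Real.sqrt_le_sqrt (by nlinarith)
  set X := d * Real.log T * √(K * T) with hX
  have hX0 : 0 ≤ X := by positivity
  -- Terms without the factor `d log T` are absorbed through `d log T ≥ log 2 = 1/c`.
  have hKT : √(K * T) ≤ c * X := by
    rw [hc, hX, one_div_mul_eq_div, le_div_iff₀ hl2, mul_comm]
    refine mul_le_mul_of_nonneg_right ?_ (Real.sqrt_nonneg _)
    nlinarith
  have h1 : 1 ≤ c * X := (Real.one_le_sqrt.2 (by nlinarith)).trans hKT
  have hsq : √(T * Real.log T) ≤ c * X := by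
    rw [Real.sqrt_mul (by positivity), hc, hX, one_div_mul_eq_div, le_div_iff₀ hl2]
    have h2 : Real.log 2 ≤ √(Real.log T) := by
      refine Real.le_sqrt_of_sq_le ?_
      have : Real.log 2 ≤ 1 := by linarith [Real.log_two_lt_d9]
      nlinarith
    have h3 : √(Real.log T) * Real.log 2 ≤ d * Real.log T := by
      calc √(Real.log T) * Real.log 2 ≤ √(Real.log T) * √(Real.log T) := by gcongr
        _ = 1 * Real.log T := by rw [Real.mul_self_sqrt hlT0.le, one_mul]
        _ ≤ d * Real.log T := by gcongr
    calc √(T : ℝ) * √(Real.log T) * Real.log 2 = √(Real.log T) * Real.log 2 * √(T : ℝ) := by ring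
      _ ≤ d * Real.log T * √(K * T) := by gcongr
  have hwT : W * (d * Real.log T) * √(T : ℝ) ≤ W * X := by
    rw [hX, mul_assoc]
    gcongr
  constructor
  · intro hgap i σ' hadm
    have hu := StrategicBandit.utility_deviation_sub_le (P := ⟨T, lam, S⟩) hlam hT hd hK hE hΔ hgap
      (fun j hj => Function.update_of_ne hj _ _) hadm
    have ht := StrategicBandit.numOptimal_sub_utility_le (P := ⟨T, lam, S⟩) (tie := tie) hlam hT hd
      hK hE hΔ i
    simp only [← hWdef, ← hX] at hu ht
    have hb : (Δ + 2 * (W * (d * Real.log T) * √(T : ℝ)) + 4 * √(T * Real.log T)) / Δ ≤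
        c * X + (2 * (W * X) + 4 * (c * X)) / Δ := by
      rw [add_assoc, add_div, div_self hΔ.ne']
      gcongr
    have hsplit : ((4 * W + 4 * c) / Δ + 7 * c + (2 * W + 4 * S * c)) * X =
        (c * X + (2 * (W * X) + 4 * (c * X)) / Δ) + 4 * (c * X) +
          (2 * W * X / Δ + 2 * (c * X)) + (2 * W + 4 * S * c) * X := by
      field_simp
      ring
    have hpos : 0 ≤ (2 * W + 4 * S * c) * X := by positivity
    rw [hsplit]
    linarith
  · have hr := StrategicBandit.regret_truthful_le (P := ⟨T, lam, S⟩) (tie := tie) hlam hT hd hK hE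
    simp only [← hWdef, ← hX] at hr
    have h2 : 2 * S * (2 * √(K * T)) ≤ 2 * S * (2 * (c * X)) := by gcongr
    have hpos : 0 ≤ ((4 * W + 4 * c) / Δ + 7 * c) * X := by positivity
    have hsplit : ((4 * W + 4 * c) / Δ + 7 * c + (2 * W + 4 * S * c)) * X =
        ((4 * W + 4 * c) / Δ + 7 * c) * X + (2 * W * X + 2 * S * (2 * (c * X))) := by ring
    rw [hsplit]
    linarith
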